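/- \textbf{Conventions.} In a category $\mathcal C$ with pullbacks let $p^{*}\colon \mathcal C/B\to\mathcal C/E$ be the change-of-base functor given by pullback along $p\colon E\to B$, and let $\mathrm{Desc}(p)$ be the category of descent data relative to $p$ for the pseudofunctor $\mathcal C^{\mathrm{op}}\to\mathbf{CAT}$, $B\mapsto \mathcal C/B$, $p\mapsto p^{*}$ (the basic fibration). The morphism $p$ is \emph{of effective descent} if the comparison functor $\mathcal C/B\to\mathrm{Desc}(p)$ is an equivalence. A (locally small) category $V$ is \emph{infinitary lextensive} if it has finite limits and small coproducts, and every small coproduct cocone $(A_i\to A)_{i\in I}$ is van Kampen (that is, coproducts are disjoint and stable under pullback): for every family of morphisms $A'_i\to A_i$, every cocone $(A'_i\to A')_{i\in I}$ and every compatible morphism $A'\to A$, the cocone $(A'_i\to A')_{i\in I}$ is a coproduct if and only if, for every $i$, the square formed by $A'_i\to A'$, $A'_i\to A_i$, $A'\to A$ and $A_i\to A$ is a pullback. For such a $V$, regarded as a monoidal category $(V,\times,I)$ with finite products, let $V\textrm{-}\mathrm{Cat}$ be the category of small $V$-enriched categories and $V$-functors, let $\mathrm{Cat}(V)$ be the category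 of internal categories and internal functors in $V$ (both have pullbacks), and let $\iota\colon V\textrm{-}\mathrm{Cat}\to\mathrm{Cat}(V)$ be the functor which sends a $V$-category $X$ to the internal category with object of objects $\coprod_{x\in \mathrm{ob}X} I$ and object of arrows $\coprod_{(x,y)\in \mathrm{ob}X\times \mathrm{ob}X} X(x,y)$, whose structure maps are induced by those of $X$, and which sends a $V$-functor to the internal functor induced on the coproducts. \textbf{Theorem.} Let $(V,\times,I)$ be an infinitary lextensive category in which every morphism factors as a regular epimorphism followed by a monomorphism, and suppose that the functor $$J\colon \mathbf{Set}\to V,\qquad A\mapsto \coprod_{a\in A} I,$$ is fully faithful. Then $\iota\colon V\textrm{-}\mathrm{Cat}\to \mathrm{Cat}(V)$ is a fully faithful and pullback-preserving functor, and it reflects effective descent morphisms: for every morphism $p$ of $V\textrm{-}\mathrm{Cat}$, if $\iota(p)$ is of effective descent in $\mathrm{Cat}(V)$, then $p$ is of effective descent in $V\textrm{-}\mathrm{Cat}$. -/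

import Mathlib

open CategoryTheory CategoryTheory.Limits MonoidalCategory CartesianMonoidalCategory

universe w v u

noncomputable section

namespace EnrichedDescent

section BasicFibration
variable {C : Type u} [Category.{v} C] [HasPullbacks C]

/-- The change of base functor `p^* : C/B ⥤ C/E`. -/
def baseChange {E B : C} (p : E ⟶ B) : Over B ⥤ Over E := Over.pullback p

/-- The projection from the total object of `p^* A` to the total object of `A`. -/
def baseChangeFst {E B : C} (p : E ⟶ B) (A : Over B) : ((baseChange p).obj A).left ⟶ A.left :=
  pullback.fst A.hom p

/-- The morphism to the total object of `p^* A` given by the universal property. -/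
def baseChangeLift {E B : C} (p : E ⟶ B) (A : Over B) {T : C} (a : T ⟶ A.left) (e : T ⟶ E)
    (h : a ≫ A.hom = e ≫ p) : T ⟶ ((baseChange p).obj A).left :=
  pullback.lift a e h

lemma baseChangeFst_condition {E B : C} (p : E ⟶ B) (A : Over B) :
    baseChangeFst p A ≫ A.hom = ((baseChange p).obj A).hom ≫ p :=
  pullback.condition

lemma baseChangeFst_condition_assoc {E B : C} (p : E ⟶ B) (A : Over B) {S : C} (k : B ⟶ S) :
    baseChangeFst p A ≫ A.hom ≫ k = ((baseChange p).obj A).hom ≫ p ≫ k :=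
  (reassoc_of% (baseChangeFst_condition p A)) k

@[simp]
lemma baseChangeLift_fst {E B : C} (p : E ⟶ B) (A : Over B) {T : C} (a : T ⟶ A.left) (e : T ⟶ E)
    (h : a ≫ A.hom = e ≫ p) : baseChangeLift p A a e h ≫ baseChangeFst p A = a :=
  pullback.lift_fst _ _ _

@[simp] lemma baseChangeLift_fst_assoc {E B : C} (p : E ⟶ B) (A : Over B) {T : C} (a : T ⟶ A.left)
    (e : T ⟶ E) (h : a ≫ A.hom = e ≫ p) {S : C} (k : A.left ⟶ S) :
    baseChangeLift p A a e h ≫ baseChangeFst p A ≫ k = a ≫ k :=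
  (reassoc_of% (baseChangeLift_fst p A a e h)) k

@[simp]
lemma baseChangeLift_hom {E B : C} (p : E ⟶ B) (A : Over B) {T : C} (a : T ⟶ A.left) (e : T ⟶ E)
    (h : a ≫ A.hom = e ≫ p) : baseChangeLift p A a e h ≫ ((baseChange p).obj A).hom = e :=
  pullback.lift_snd _ _ _

@[simp] lemma baseChangeLift_hom_assoc {E B : C} (p : E ⟶ B) (A : Over B) {T : C} (a : T ⟶ A.left)
    (e : T ⟶ E) (h : a ≫ A.hom = e ≫ p) {S : C} (k : E ⟶ S) :
    baseChangeLift p A a e h ≫ ((baseChange p).obj A).hom ≫ k = e ≫ k :=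
  (reassoc_of% (baseChangeLift_hom p A a e h)) k

lemma baseChange_hom_ext {E B : C} (p : E ⟶ B) (A : Over B) {T : C}
    {a b : T ⟶ ((baseChange p).obj A).left}
    (h₁ : a ≫ baseChangeFst p A = b ≫ baseChangeFst p A)
    (h₂ : a ≫ ((baseChange p).obj A).hom = b ≫ ((baseChange p).obj A).hom) : a = b :=
  pullback.hom_ext h₁ h₂

@[simp]
lemma baseChange_map_left_fst {E B : C} (p : E ⟶ B) {A A' : Over B} (f : A ⟶ A') :
    ((baseChange p).map f).left ≫ baseChangeFst p A' = baseChangeFst p A ≫ f.left :=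
  pullback.lift_fst _ _ _

@[simp] lemma baseChange_map_left_fst_assoc {E B : C} (p : E ⟶ B) {A A' : Over B} (f : A ⟶ A') {S : C}
    (k : A'.left ⟶ S) :
    ((baseChange p).map f).left ≫ baseChangeFst p A' ≫ k = baseChangeFst p A ≫ f.left ≫ k :=
  (reassoc_of% (baseChange_map_left_fst p f)) k

/-- Base change along an identity is isomorphic to the identity. -/
def baseChangeId (X : C) : baseChange (𝟙 X) ≅ 𝟭 (Over X) :=
  NatIso.ofComponents (fun A ↦ Over.isoMk
    { hom := baseChangeFst (𝟙 X) A
      inv := baseChangeLift (𝟙 X) A (𝟙 _) A.hom (by simp)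
      hom_inv_id := baseChange_hom_ext _ _ (by simp) (by simp [baseChangeFst_condition])
      inv_hom_id := by simp }
    (by simp [baseChangeFst_condition]))
    (fun f ↦ by ext; simp)

/-- Base change along a composite is isomorphic to the composite of the base changes. -/
def baseChangeComp {X Y Z : C} (f : X ⟶ Y) (g : Y ⟶ Z) :
    baseChange (f ≫ g) ≅ baseChange g ⋙ baseChange f :=
  NatIso.ofComponents (fun A ↦ Over.isoMk
    { hom := baseChangeLift f ((baseChange g).obj A)
        (baseChangeLift g A (baseChangeFst (f ≫ g) A) (((baseChange (f ≫ g)).obj A).hom ≫ f)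
          (by simp [baseChangeFst_condition])) ((baseChange (f ≫ g)).obj A).hom (by simp)
      inv := baseChangeLift (f ≫ g) A (baseChangeFst f _ ≫ baseChangeFst g _)
        ((baseChange f).obj ((baseChange g).obj A)).hom
        (by simp [baseChangeFst_condition, baseChangeFst_condition_assoc])
      hom_inv_id := baseChange_hom_ext _ _ (by simp) (by simp)
      inv_hom_id := baseChange_hom_ext _ _
        (baseChange_hom_ext _ _ (by simp) (by simp [baseChangeFst_condition]))
        (by simp) }
    (by simp))
    (fun h ↦ by
      ext
      exact baseChange_hom_ext _ _ (baseChange_hom_ext _ _ (by simp) (by simp)) (by simp))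

lemma baseChangeId_hom_app_left {X : C} (A : Over X) :
    ((baseChangeId X).hom.app A).left = baseChangeFst (𝟙 X) A := rfl

lemma baseChangeComp_hom_app_left_fst_fst {X Y Z : C} (f : X ⟶ Y) (g : Y ⟶ Z) (A : Over Z) :
    ((baseChangeComp f g).hom.app A).left ≫ baseChangeFst f ((baseChange g).obj A) ≫
      baseChangeFst g A = baseChangeFst (f ≫ g) A := by
  simp [baseChangeComp]

lemma baseChangeComp_inv_app_left_fst {X Y Z : C} (f : X ⟶ Y) (g : Y ⟶ Z) (A : Over Z) :
    ((baseChangeComp f g).inv.app A).left ≫ baseChangeFst (f ≫ g) A =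
      baseChangeFst f ((baseChange g).obj A) ≫ baseChangeFst g A := by
  simp [baseChangeComp]

lemma eqToHom_baseChange {X Y : C} {f g : X ⟶ Y} (h : f = g)
    (h' : (baseChange f).toCatHom = (baseChange g).toCatHom) (A : Over Y) :
    ((eqToHom h').toNatTrans.app A).left ≫ baseChangeFst g A = baseChangeFst f A := by
  subst h
  exact Category.id_comp _

lemma baseChange_assoc {W X Y Z : C} (f : W ⟶ X) (g : X ⟶ Y) (h : Y ⟶ Z) (A : Over Z) :
    (((baseChangeComp f (g ≫ h)).hom.app A).left ≫
      ((baseChange f).map ((baseChangeComp g h).hom.app A)).left ≫ 𝟙 _ ≫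
      ((baseChangeComp f g).inv.app ((baseChange h).obj A)).left ≫
      ((baseChangeComp (f ≫ g) h).inv.app A).left) ≫
      baseChangeFst ((f ≫ g) ≫ h) A = baseChangeFst (f ≫ g ≫ h) A := by
  dsimp
  simp only [Category.assoc, Category.id_comp]
  rw [baseChangeComp_inv_app_left_fst, reassoc_of% (baseChangeComp_inv_app_left_fst f g ((baseChange h).obj A)),
    baseChange_map_left_fst_assoc, baseChangeComp_hom_app_left_fst_fst,
    baseChangeComp_hom_app_left_fst_fst]

lemma baseChange_comp_id {X Y : C} (f : X ⟶ Y) (A : Over Y) :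
    (((baseChangeComp f (𝟙 Y)).hom.app A).left ≫
      ((baseChange f).map ((baseChangeId Y).hom.app A)).left ≫ 𝟙 _) ≫
      baseChangeFst f A = baseChangeFst (f ≫ 𝟙 Y) A := by
  dsimp
  simp only [Category.assoc, Category.id_comp]
  rw [baseChange_map_left_fst, baseChangeId_hom_app_left, baseChangeComp_hom_app_left_fst_fst]

lemma baseChange_id_comp {X Y : C} (f : X ⟶ Y) (A : Over Y) :
    (((baseChangeComp (𝟙 X) f).hom.app A).left ≫
      ((baseChangeId X).hom.app ((baseChange f).obj A)).left ≫ 𝟙 _) ≫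
      baseChangeFst f A = baseChangeFst (𝟙 X ≫ f) A := by
  dsimp
  simp only [Category.assoc, Category.id_comp]
  rw [baseChangeId_hom_app_left, baseChangeComp_hom_app_left_fst_fst]

variable (C)
/-- The basic fibration of `C`: the pseudofunctor sending `B` to `C/B` and `p : E ⟶ B` to the
change of base functor `p^* : C/B ⥤ C/E`. -/
def basicFibration : Pseudofunctor (LocallyDiscrete Cᵒᵖ) Cat.{v, max u v} :=
  LocallyDiscrete.mkPseudofunctor
    (fun X ↦ Cat.of (Over X.unop))
    (fun f ↦ (baseChange f.unop).toCatHom)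
    (fun X ↦ Cat.Hom.isoMk (baseChangeId X.unop))
    (fun f g ↦ Cat.Hom.isoMk (baseChangeComp g.unop f.unop))
    (fun f g h ↦ by
      ext A
      refine Over.OverMorphism.ext (baseChange_hom_ext _ _ ?_ ((Over.w _).trans (Over.w _).symm))
      exact (baseChange_assoc h.unop g.unop f.unop A).trans
        (eqToHom_baseChange (Category.assoc h.unop g.unop f.unop).symm _ A).symm)
    (fun f ↦ by
      ext A
      refine Over.OverMorphism.ext (baseChange_hom_ext _ _ ?_ ((Over.w _).trans (Over.w _).symm))
      exact (baseChange_comp_id f.unop A).trans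
        (eqToHom_baseChange (Category.comp_id f.unop) _ A).symm)
    (fun f ↦ by
      ext A
      refine Over.OverMorphism.ext (baseChange_hom_ext _ _ ?_ ((Over.w _).trans (Over.w _).symm))
      exact (baseChange_id_comp f.unop A).trans
        (eqToHom_baseChange (Category.id_comp f.unop) _ A).symm)

/-- A morphism is of effective descent (w.r.t. the basic fibration) if the comparison functor
from `C/B` to the category of descent data relative to `p` is an equivalence. -/
def IsEffectiveDescent {C : Type u} [Category.{v} C] [HasPullbacks C] {E B : C} (p : E ⟶ B) :
    Prop :=
  ((basicFibration C).toDescentData (fun _ : PUnit.{1} ↦ p)).IsEquivalence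

end BasicFibration

section Internal

attribute [local simp] pullback.lift_fst pullback.lift_snd pullback.lift_fst_assoc
  pullback.lift_snd_assoc

/-- An internal category in a category with pullbacks. Composition is in diagrammatic order:
its domain is the object of pairs of arrows `(f, g)` such that the target of `f` is the source
of `g`. -/
structure InternalCat (V : Type u) [Category.{v} V] [HasPullbacks V] where
  /-- The object of objects. -/
  obj : V
  /-- The object of arrows. -/
  arr : V
  /-- The source. -/
  src : arr ⟶ obj
  /-- The target. -/
  tgt : arr ⟶ obj
  /-- The identities. -/
  ident : obj ⟶ arr
  /-- The composition. -/
  comp : pullback tgt src ⟶ arr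
  ident_src : ident ≫ src = 𝟙 obj
  ident_tgt : ident ≫ tgt = 𝟙 obj
  comp_src : comp ≫ src = pullback.fst tgt src ≫ src
  comp_tgt : comp ≫ tgt = pullback.snd tgt src ≫ tgt
  id_comp : pullback.lift (src ≫ ident) (𝟙 arr) (by simp [ident_tgt]) ≫ comp = 𝟙 arr
  comp_id : pullback.lift (𝟙 arr) (tgt ≫ ident) (by simp [ident_src]) ≫ comp = 𝟙 arr
  assoc :
    pullback.lift (pullback.fst (pullback.snd tgt src ≫ tgt) src ≫ comp)
        (pullback.snd (pullback.snd tgt src ≫ tgt) src)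
        (by rw [Category.assoc, comp_tgt, pullback.condition]) ≫ comp =
      pullback.lift
        (pullback.fst (pullback.snd tgt src ≫ tgt) src ≫ pullback.fst tgt src)
        (pullback.lift (pullback.fst (pullback.snd tgt src ≫ tgt) src ≫ pullback.snd tgt src)
          (pullback.snd (pullback.snd tgt src ≫ tgt) src)
          (by rw [Category.assoc, pullback.condition]) ≫ comp)
        (by rw [Category.assoc, Category.assoc, comp_src, pullback.lift_fst_assoc,
          Category.assoc, pullback.condition]) ≫ comp

attribute [simp] InternalCat.ident_src InternalCat.ident_tgt InternalCat.comp_src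
  InternalCat.comp_tgt

namespace InternalCat
variable {V : Type u} [Category.{v} V] [HasPullbacks V] (X : InternalCat V) {S : V}

@[simp] lemma ident_src_assoc (k : X.obj ⟶ S) : X.ident ≫ X.src ≫ k = k := by
  rw [← Category.assoc, X.ident_src, Category.id_comp]

@[simp] lemma ident_tgt_assoc (k : X.obj ⟶ S) : X.ident ≫ X.tgt ≫ k = k := by
  rw [← Category.assoc, X.ident_tgt, Category.id_comp]

@[simp] lemma comp_src_assoc (k : X.obj ⟶ S) :
    X.comp ≫ X.src ≫ k = pullback.fst X.tgt X.src ≫ X.src ≫ k := (reassoc_of% X.comp_src) k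

@[simp] lemma comp_tgt_assoc (k : X.obj ⟶ S) :
    X.comp ≫ X.tgt ≫ k = pullback.snd X.tgt X.src ≫ X.tgt ≫ k := (reassoc_of% X.comp_tgt) k

end InternalCat

/-- An internal functor. -/
@[ext]
structure InternalFunctor {V : Type u} [Category.{v} V] [HasPullbacks V]
    (X Y : InternalCat V) where
  /-- The action on objects. -/
  obj : X.obj ⟶ Y.obj
  /-- The action on arrows. -/
  arr : X.arr ⟶ Y.arr
  arr_src : arr ≫ Y.src = X.src ≫ obj
  arr_tgt : arr ≫ Y.tgt = X.tgt ≫ obj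
  ident_arr : X.ident ≫ arr = obj ≫ Y.ident
  comp_arr : X.comp ≫ arr =
    pullback.lift (pullback.fst X.tgt X.src ≫ arr) (pullback.snd X.tgt X.src ≫ arr)
      (by rw [Category.assoc, Category.assoc, arr_src, arr_tgt, pullback.condition_assoc]) ≫
      Y.comp

attribute [simp] InternalFunctor.arr_src InternalFunctor.arr_tgt InternalFunctor.ident_arr

variable {V : Type u} [Category.{v} V] [HasPullbacks V]

namespace InternalFunctor
variable {X Y : InternalCat V} (F : InternalFunctor X Y) {S : V}

@[simp] lemma arr_src_assoc (k : Y.obj ⟶ S) : F.arr ≫ Y.src ≫ k = X.src ≫ F.obj ≫ k :=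
  (reassoc_of% F.arr_src) k

@[simp] lemma arr_tgt_assoc (k : Y.obj ⟶ S) : F.arr ≫ Y.tgt ≫ k = X.tgt ≫ F.obj ≫ k :=
  (reassoc_of% F.arr_tgt) k

@[simp] lemma ident_arr_assoc (k : Y.arr ⟶ S) : X.ident ≫ F.arr ≫ k = F.obj ≫ Y.ident ≫ k :=
  (reassoc_of% F.ident_arr) k

end InternalFunctor

namespace InternalCat

/-- Composition of generalized elements of the object of arrows. -/
def mul (X : InternalCat V) {T : V} (f g : T ⟶ X.arr) (h : f ≫ X.tgt = g ≫ X.src) : T ⟶ X.arr :=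
  pullback.lift f g h ≫ X.comp

variable (X : InternalCat V) {T : V}

lemma comp_mul {S : V} (t : S ⟶ T) (f g : T ⟶ X.arr) (h : f ≫ X.tgt = g ≫ X.src) :
    t ≫ X.mul f g h = X.mul (t ≫ f) (t ≫ g) (by simp [h]) := by
  unfold mul
  rw [← Category.assoc]
  congr 1
  ext <;> simp

@[simp]
lemma mul_src (f g : T ⟶ X.arr) (h : f ≫ X.tgt = g ≫ X.src) :
    X.mul f g h ≫ X.src = f ≫ X.src := by simp [mul]

@[simp] lemma mul_src_assoc (f g : T ⟶ X.arr) (h : f ≫ X.tgt = g ≫ X.src) {S : V} (k : X.obj ⟶ S) :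
    X.mul f g h ≫ X.src ≫ k = f ≫ X.src ≫ k := (reassoc_of% (X.mul_src f g h)) k

@[simp]
lemma mul_tgt (f g : T ⟶ X.arr) (h : f ≫ X.tgt = g ≫ X.src) :
    X.mul f g h ≫ X.tgt = g ≫ X.tgt := by simp [mul]

@[simp] lemma mul_tgt_assoc (f g : T ⟶ X.arr) (h : f ≫ X.tgt = g ≫ X.src) {S : V} (k : X.obj ⟶ S) :
    X.mul f g h ≫ X.tgt ≫ k = g ≫ X.tgt ≫ k := (reassoc_of% (X.mul_tgt f g h)) k

lemma comp_eq_mul : X.comp = X.mul (pullback.fst _ _) (pullback.snd _ _) pullback.condition := by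
  have : pullback.lift (pullback.fst X.tgt X.src) (pullback.snd X.tgt X.src) pullback.condition =
    𝟙 _ := by ext <;> simp
  simp [mul, this]

lemma id_mul (f : T ⟶ X.arr) : X.mul (f ≫ X.src ≫ X.ident) f (by simp) = f := by
  have := f ≫= X.id_comp
  rw [← mul, comp_mul] at this
  simpa using this

lemma mul_id (f : T ⟶ X.arr) : X.mul f (f ≫ X.tgt ≫ X.ident) (by simp) = f := by
  have := f ≫= X.comp_id
  rw [← mul, comp_mul] at this
  simpa using this

lemma mul_assoc (f g k : T ⟶ X.arr) (h : f ≫ X.tgt = g ≫ X.src) (h' : g ≫ X.tgt = k ≫ X.src) :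
    X.mul (X.mul f g h) k (by simp [h']) = X.mul f (X.mul g k h') (by simp [h]) := by
  have e : X.mul (pullback.fst (pullback.snd X.tgt X.src ≫ X.tgt) X.src ≫ X.comp)
        (pullback.snd (pullback.snd X.tgt X.src ≫ X.tgt) X.src)
        (by rw [Category.assoc, X.comp_tgt, pullback.condition]) =
      X.mul (pullback.fst (pullback.snd X.tgt X.src ≫ X.tgt) X.src ≫ pullback.fst X.tgt X.src)
        (X.mul (pullback.fst (pullback.snd X.tgt X.src ≫ X.tgt) X.src ≫ pullback.snd X.tgt X.src)
          (pullback.snd (pullback.snd X.tgt X.src ≫ X.tgt) X.src)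
          (by rw [Category.assoc, pullback.condition]))
        (by rw [Category.assoc, X.mul_src, Category.assoc, pullback.condition]) := X.assoc
  have := pullback.lift (f := pullback.snd X.tgt X.src ≫ X.tgt) (pullback.lift f g h) k
    (by simp [h']) ≫= e
  simpa [comp_mul, comp_eq_mul] using this

end InternalCat

lemma InternalFunctor.mul_arr {X Y : InternalCat V} (F : InternalFunctor X Y) {T : V}
    (f g : T ⟶ X.arr) (h : f ≫ X.tgt = g ≫ X.src) :
    X.mul f g h ≫ F.arr = Y.mul (f ≫ F.arr) (g ≫ F.arr)
      (by simp [reassoc_of% h]) := by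
  rw [InternalCat.mul, Category.assoc, F.comp_arr, ← InternalCat.mul, InternalCat.comp_mul]
  simp

/-- The category of internal categories and internal functors. -/
instance : Category (InternalCat V) where
  Hom X Y := InternalFunctor X Y
  id X :=
    { obj := 𝟙 _
      arr := 𝟙 _
      arr_src := by simp
      arr_tgt := by simp
      ident_arr := by simp
      comp_arr := by
        rw [← InternalCat.mul, Category.comp_id, InternalCat.comp_eq_mul]
        simp }
  comp {X Y Z} F G :=
    { obj := F.obj ≫ G.obj
      arr := F.arr ≫ G.arr
      arr_src := by simp
      arr_tgt := by simp
      ident_arr := by simp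
      comp_arr := by
        rw [← InternalCat.mul, InternalCat.comp_eq_mul, reassoc_of% F.mul_arr, G.mul_arr]
        simp }
  id_comp F := by apply InternalFunctor.ext <;> simp
  comp_id F := by apply InternalFunctor.ext <;> simp
  assoc F G H := by apply InternalFunctor.ext <;> simp

namespace InternalCat

@[simp] lemma id_obj (X : InternalCat V) : InternalFunctor.obj (𝟙 X) = 𝟙 _ := rfl
@[simp] lemma id_arr (X : InternalCat V) : InternalFunctor.arr (𝟙 X) = 𝟙 _ := rfl
@[simp] lemma comp_obj {X Y Z : InternalCat V} (F : X ⟶ Y) (G : Y ⟶ Z) :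
    (F ≫ G).obj = F.obj ≫ G.obj := rfl
@[simp] lemma comp_arr {X Y Z : InternalCat V} (F : X ⟶ Y) (G : Y ⟶ Z) :
    (F ≫ G).arr = F.arr ≫ G.arr := rfl
@[ext] lemma hom_ext {X Y : InternalCat V} {F G : X ⟶ Y} (h : F.obj = G.obj)
    (h' : F.arr = G.arr) : F = G := InternalFunctor.ext h h'

lemma mul_congr (X : InternalCat V) {T : V} {f g f' g' : T ⟶ X.arr}
    {h : f ≫ X.tgt = g ≫ X.src} (hf : f = f') (hg : g = g') :
    X.mul f g h = X.mul f' g' (by rw [← hf, ← hg, h]) := by subst hf hg; rfl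

section Pullback
variable {X Y Z : InternalCat V} (F : X ⟶ Z) (G : Y ⟶ Z)

/-- The pullback of internal categories. -/
def pullbackCat : InternalCat V where
  obj := pullback F.obj G.obj
  arr := pullback F.arr G.arr
  src := pullback.map _ _ _ _ X.src Y.src Z.src (by simp) (by simp)
  tgt := pullback.map _ _ _ _ X.tgt Y.tgt Z.tgt (by simp) (by simp)
  ident := pullback.map _ _ _ _ X.ident Y.ident Z.ident (by simp) (by simp)
  comp := pullback.lift
    (X.mul (pullback.fst _ _ ≫ pullback.fst _ _) (pullback.snd _ _ ≫ pullback.fst _ _) (by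
      have := pullback.condition (f := pullback.map F.arr G.arr F.obj G.obj X.tgt Y.tgt Z.tgt
        (by simp) (by simp)) (g := pullback.map F.arr G.arr F.obj G.obj X.src Y.src Z.src
        (by simp) (by simp)) =≫ pullback.fst _ _
      simpa using this))
    (Y.mul (pullback.fst _ _ ≫ pullback.snd _ _) (pullback.snd _ _ ≫ pullback.snd _ _) (by
      have := pullback.condition (f := pullback.map F.arr G.arr F.obj G.obj X.tgt Y.tgt Z.tgt
        (by simp) (by simp)) (g := pullback.map F.arr G.arr F.obj G.obj X.src Y.src Z.src
        (by simp) (by simp)) =≫ pullback.snd _ _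
      simpa using this))
    (by simp [InternalFunctor.mul_arr, pullback.condition])
  ident_src := by ext <;> simp
  ident_tgt := by ext <;> simp
  comp_src := by ext <;> simp
  comp_tgt := by ext <;> simp
  id_comp := by
    ext <;> simp [comp_mul, id_mul]
  comp_id := by
    ext <;> simp [comp_mul, mul_id]
  assoc := by
    ext <;> simp only [Category.assoc, comp_mul, pullback.lift_fst, pullback.lift_snd,
      pullback.lift_fst_assoc, pullback.lift_snd_assoc]
    · exact X.mul_assoc _ _ _ _ _
    · exact Y.mul_assoc _ _ _ _ _

/-- The first projection from the pullback of internal categories. -/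
def pullbackFst : pullbackCat F G ⟶ X where
  obj := pullback.fst _ _
  arr := pullback.fst _ _
  arr_src := by simp [pullbackCat]
  arr_tgt := by simp [pullbackCat]
  ident_arr := by simp [pullbackCat]
  comp_arr := pullback.lift_fst _ _ _

/-- The second projection from the pullback of internal categories. -/
def pullbackSnd : pullbackCat F G ⟶ Y where
  obj := pullback.snd _ _
  arr := pullback.snd _ _
  arr_src := by simp [pullbackCat]
  arr_tgt := by simp [pullbackCat]
  ident_arr := by simp [pullbackCat]
  comp_arr := pullback.lift_snd _ _ _

variable {F G} in
/-- The universal property of the pullback of internal categories. -/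
def pullbackLift {T : InternalCat V} (a : T ⟶ X) (b : T ⟶ Y) (h : a ≫ F = b ≫ G) :
    T ⟶ pullbackCat F G where
  obj := pullback.lift a.obj b.obj (congrArg InternalFunctor.obj h)
  arr := pullback.lift a.arr b.arr (congrArg InternalFunctor.arr h)
  arr_src := by refine pullback.hom_ext ?_ ?_ <;> simp [pullbackCat]
  arr_tgt := by refine pullback.hom_ext ?_ ?_ <;> simp [pullbackCat]
  ident_arr := by refine pullback.hom_ext ?_ ?_ <;> simp [pullbackCat]
  comp_arr := by
    refine pullback.hom_ext ?_ ?_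
    · simp only [pullbackCat, Category.assoc, pullback.lift_fst, comp_mul]
      exact a.comp_arr.trans (X.mul_congr
        (Eq.symm ((pullback.lift_fst_assoc _ _ _ _).trans (by simp)))
        (Eq.symm ((pullback.lift_snd_assoc _ _ _ _).trans (by simp))))
    · simp only [pullbackCat, Category.assoc, pullback.lift_snd, comp_mul]
      exact b.comp_arr.trans (Y.mul_congr
        (Eq.symm ((pullback.lift_fst_assoc _ _ _ _).trans (by simp)))
        (Eq.symm ((pullback.lift_snd_assoc _ _ _ _).trans (by simp))))

lemma isPullback_pullbackCat :
    IsPullback (pullbackFst F G) (pullbackSnd F G) F G where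
  w := InternalCat.hom_ext pullback.condition pullback.condition
  isLimit' := ⟨PullbackCone.IsLimit.mk _ (fun s ↦ pullbackLift s.fst s.snd s.condition)
    (fun _ ↦ InternalCat.hom_ext (pullback.lift_fst _ _ _) (pullback.lift_fst _ _ _))
    (fun _ ↦ InternalCat.hom_ext (pullback.lift_snd _ _ _) (pullback.lift_snd _ _ _))
    (fun _ _ h₁ h₂ ↦ InternalCat.hom_ext
      (pullback.hom_ext
        ((congrArg InternalFunctor.obj h₁).trans (pullback.lift_fst _ _ _).symm)
        ((congrArg InternalFunctor.obj h₂).trans (pullback.lift_snd _ _ _).symm))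
      (pullback.hom_ext
        ((congrArg InternalFunctor.arr h₁).trans (pullback.lift_fst _ _ _).symm)
        ((congrArg InternalFunctor.arr h₂).trans (pullback.lift_snd _ _ _).symm)))⟩

end Pullback

instance : HasPullbacks (InternalCat V) :=
  have (X Y Z : InternalCat V) (F : X ⟶ Z) (G : Y ⟶ Z) : HasLimit (cospan F G) :=
    (isPullback_pullbackCat F G).hasPullback
  hasPullbacks_of_hasLimit_cospan _

end InternalCat
end Internal

section Enriched
attribute [local simp] pullback.lift_fst pullback.lift_snd pullback.lift_fst_assoc
  pullback.lift_snd_assoc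

/-- The category `V`-`Cat` of small `V`-enriched categories and `V`-functors. -/
structure VCat (V : Type u) [Category.{v} V] [MonoidalCategory V] where
  /-- The set of objects. -/
  carrier : Type w
  /-- The enrichment. -/
  [str : EnrichedCategory V carrier]

section
variable {V : Type u} [Category.{v} V] [MonoidalCategory V]

instance : CoeSort (VCat.{w} V) (Type w) := ⟨VCat.carrier⟩

instance (X : VCat.{w} V) : EnrichedCategory V X := X.str

instance : Category (VCat.{w} V) where
  Hom X Y := EnrichedFunctor V X Y
  id X := EnrichedFunctor.id V X
  comp F G := F.comp V G
  id_comp _ := EnrichedFunctor.ext V (fun _ ↦ rfl)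
    (fun _ _ ↦ (Category.comp_id _).trans (Category.id_comp _))
  comp_id _ := EnrichedFunctor.ext V (fun _ ↦ rfl)
    (fun _ _ ↦ (Category.comp_id _).trans (Category.comp_id _))
  assoc _ _ _ := EnrichedFunctor.ext V (fun _ ↦ rfl)
    (fun _ _ ↦ (Category.comp_id _).trans (Category.assoc _ _ _))

namespace VCat

@[simp] lemma id_obj (X : VCat.{w} V) (x : X) : EnrichedFunctor.obj (𝟙 X) x = x := rfl
@[simp] lemma id_map (X : VCat.{w} V) (x y : X) : EnrichedFunctor.map (𝟙 X) x y = 𝟙 _ := rfl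
@[simp] lemma comp_obj {X Y Z : VCat.{w} V} (F : X ⟶ Y) (G : Y ⟶ Z) (x : X) :
    EnrichedFunctor.obj (F ≫ G) x = G.obj (F.obj x) := rfl
@[simp] lemma comp_map {X Y Z : VCat.{w} V} (F : X ⟶ Y) (G : Y ⟶ Z) (x y : X) :
    EnrichedFunctor.map (F ≫ G) x y = F.map x y ≫ G.map (F.obj x) (F.obj y) := rfl

/-- The isomorphism of hom-objects induced by equalities of objects. -/
def castHom {X : Type w} [EnrichedCategory V X] {x x' y y' : X} (h : x = x') (h' : y = y') :
    (x ⟶[V] y) ⟶ (x' ⟶[V] y') :=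
  eqToHom (by rw [h, h'])

section castHom
variable {X : Type w} [EnrichedCategory V X]

@[simp] lemma castHom_rfl (x y : X) : castHom (rfl : x = x) (rfl : y = y) = 𝟙 (x ⟶[V] y) := rfl

lemma eId_castHom {x x' : X} (h : x = x') : eId V x ≫ castHom h h = eId V x' := by
  subst h; simp

lemma eComp_castHom {x x' y y' z z' : X} (h₁ : x = x') (h₂ : y = y') (h₃ : z = z') :
    eComp V x y z ≫ castHom h₁ h₃ = (castHom h₁ h₂ ⊗ₘ castHom h₂ h₃) ≫ eComp V x' y' z' := by
  subst h₁ h₂ h₃; simp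

lemma map_castHom {X Y : VCat.{w} V} (F : X ⟶ Y) {x x' y y' : X} (h : x = x') (h' : y = y') :
    F.map x y ≫ castHom (congrArg F.obj h) (congrArg F.obj h') = castHom h h' ≫ F.map x' y' := by
  subst h h'; simp

lemma congr_obj {X Y : VCat.{w} V} {F G : X ⟶ Y} (h : F = G) (x : X) : F.obj x = G.obj x := by
  rw [h]

lemma congr_map {X Y : VCat.{w} V} {F G : X ⟶ Y} (h : F = G) (x y : X) :
    F.map x y ≫ castHom (congr_obj h x) (congr_obj h y) = G.map x y := by
  subst h; simp

end castHom
end VCat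
end

namespace VCat
variable {V : Type u} [Category.{v} V] [CartesianMonoidalCategory V] [HasPullbacks V]
  {X Y Z : VCat.{w} V} (F : X ⟶ Z) (G : Y ⟶ Z)

/-- The objects of the pullback of `V`-categories. -/
def PullbackObj : Type w := {p : X × Y // F.obj p.1 = G.obj p.2}

variable {F G}

/-- The hom-objects of the pullback of `V`-categories. -/
def pullbackHom (p q : PullbackObj F G) : V :=
  pullback (F.map p.1.1 q.1.1 ≫ castHom p.2 q.2) (G.map p.1.2 q.1.2)

/-- The first projection of hom-objects. -/
def pullbackHomFst (p q : PullbackObj F G) : pullbackHom p q ⟶ (p.1.1 ⟶[V] q.1.1) :=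
  pullback.fst _ _

/-- The second projection of hom-objects. -/
def pullbackHomSnd (p q : PullbackObj F G) : pullbackHom p q ⟶ (p.1.2 ⟶[V] q.1.2) :=
  pullback.snd _ _

lemma pullbackHom_condition (p q : PullbackObj F G) :
    pullbackHomFst p q ≫ F.map p.1.1 q.1.1 ≫ castHom p.2 q.2 =
      pullbackHomSnd p q ≫ G.map p.1.2 q.1.2 := pullback.condition

/-- The universal property of the hom-objects of the pullback. -/
def pullbackHomLift {p q : PullbackObj F G} {T : V} (a : T ⟶ (p.1.1 ⟶[V] q.1.1))
    (b : T ⟶ (p.1.2 ⟶[V] q.1.2))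
    (h : a ≫ F.map p.1.1 q.1.1 ≫ castHom p.2 q.2 = b ≫ G.map p.1.2 q.1.2) :
    T ⟶ pullbackHom p q := pullback.lift a b h

@[simp]
lemma pullbackHomLift_fst {p q : PullbackObj F G} {T : V} (a : T ⟶ (p.1.1 ⟶[V] q.1.1))
    (b : T ⟶ (p.1.2 ⟶[V] q.1.2)) (h) :
    pullbackHomLift a b h ≫ pullbackHomFst p q = a := pullback.lift_fst _ _ _

@[simp]
lemma pullbackHomLift_snd {p q : PullbackObj F G} {T : V} (a : T ⟶ (p.1.1 ⟶[V] q.1.1))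
    (b : T ⟶ (p.1.2 ⟶[V] q.1.2)) (h) :
    pullbackHomLift a b h ≫ pullbackHomSnd p q = b := pullback.lift_snd _ _ _

lemma pullbackHom_ext {p q : PullbackObj F G} {T : V} {a b : T ⟶ pullbackHom p q}
    (h₁ : a ≫ pullbackHomFst p q = b ≫ pullbackHomFst p q)
    (h₂ : a ≫ pullbackHomSnd p q = b ≫ pullbackHomSnd p q) : a = b :=
  pullback.hom_ext h₁ h₂

variable (F G)

instance pullbackEnriched : EnrichedCategory V (PullbackObj F G) where
  Hom p q := pullbackHom p q
  id p := pullbackHomLift (eId V p.1.1) (eId V p.1.2) (by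
    rw [EnrichedFunctor.map_id, EnrichedFunctor.map_id_assoc, eId_castHom])
  comp p q r := pullbackHomLift
    ((pullbackHomFst p q ⊗ₘ pullbackHomFst q r) ≫ eComp V _ _ _)
    ((pullbackHomSnd p q ⊗ₘ pullbackHomSnd q r) ≫ eComp V _ _ _) (by
    rw [Category.assoc, Category.assoc, EnrichedFunctor.map_comp, EnrichedFunctor.map_comp_assoc,
      eComp_castHom _ q.2, tensorHom_comp_tensorHom_assoc, tensorHom_comp_tensorHom_assoc,
      tensorHom_comp_tensorHom_assoc, ← pullbackHom_condition, ← pullbackHom_condition,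
      Category.assoc, Category.assoc])
  id_comp p q := by
    apply pullbackHom_ext
    · simp only [Category.assoc, pullbackHomLift_fst, Category.id_comp]
      rw [whiskerRight_comp_tensorHom_assoc, pullbackHomLift_fst, tensorHom_def'_assoc,
        ← leftUnitor_inv_naturality_assoc, e_id_comp, Category.comp_id]
    · simp only [Category.assoc, pullbackHomLift_snd, Category.id_comp]
      rw [whiskerRight_comp_tensorHom_assoc, pullbackHomLift_snd, tensorHom_def'_assoc,
        ← leftUnitor_inv_naturality_assoc, e_id_comp, Category.comp_id]
  comp_id p q := by
    apply pullbackHom_ext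
    · simp only [Category.assoc, pullbackHomLift_fst, Category.id_comp]
      rw [whiskerLeft_comp_tensorHom_assoc, pullbackHomLift_fst, tensorHom_def_assoc,
        ← rightUnitor_inv_naturality_assoc, e_comp_id, Category.comp_id]
    · simp only [Category.assoc, pullbackHomLift_snd, Category.id_comp]
      rw [whiskerLeft_comp_tensorHom_assoc, pullbackHomLift_snd, tensorHom_def_assoc,
        ← rightUnitor_inv_naturality_assoc, e_comp_id, Category.comp_id]
  assoc p q r s := by
    apply pullbackHom_ext
    · simp only [Category.assoc, pullbackHomLift_fst]
      rw [whiskerRight_comp_tensorHom_assoc, pullbackHomLift_fst,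
        whiskerLeft_comp_tensorHom_assoc, pullbackHomLift_fst]
      rw [← tensorHom_comp_whiskerRight_assoc, ← tensorHom_comp_whiskerLeft_assoc, ← e_assoc,
        associator_inv_naturality_assoc]
    · simp only [Category.assoc, pullbackHomLift_snd]
      rw [whiskerRight_comp_tensorHom_assoc, pullbackHomLift_snd,
        whiskerLeft_comp_tensorHom_assoc, pullbackHomLift_snd]
      rw [← tensorHom_comp_whiskerRight_assoc, ← tensorHom_comp_whiskerLeft_assoc, ← e_assoc,
        associator_inv_naturality_assoc]

/-- The pullback of `V`-categories. -/
def pullbackCat : VCat.{w} V := ⟨PullbackObj F G⟩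

/-- The first projection. -/
def pullbackFst : pullbackCat F G ⟶ X where
  obj p := p.1.1
  map p q := pullbackHomFst p q
  map_id _ := pullbackHomLift_fst _ _ _
  map_comp _ _ _ := pullbackHomLift_fst _ _ _

/-- The second projection. -/
def pullbackSnd : pullbackCat F G ⟶ Y where
  obj p := p.1.2
  map p q := pullbackHomSnd p q
  map_id _ := pullbackHomLift_snd _ _ _
  map_comp _ _ _ := pullbackHomLift_snd _ _ _

variable {F G} in
/-- The action on objects of the morphism given by the universal property of the pullback. -/
def pullbackLiftObj {T : VCat.{w} V} (a : T ⟶ X) (b : T ⟶ Y) (h : a ≫ F = b ≫ G) (x : T) :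
    PullbackObj F G := ⟨(a.obj x, b.obj x), congr_obj h x⟩

variable {F G} in
lemma pullbackLift_condition {T : VCat.{w} V} (a : T ⟶ X) (b : T ⟶ Y) (h : a ≫ F = b ≫ G)
    (x y : T) :
    a.map x y ≫ F.map (a.obj x) (a.obj y) ≫
      castHom (pullbackLiftObj a b h x).2 (pullbackLiftObj a b h y).2 =
    b.map x y ≫ G.map (b.obj x) (b.obj y) :=
  (Category.assoc _ _ _).symm.trans (congr_map h x y)

variable {F G} in
/-- The universal property of the pullback. -/
def pullbackLift {T : VCat.{w} V} (a : T ⟶ X) (b : T ⟶ Y) (h : a ≫ F = b ≫ G) :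
    T ⟶ pullbackCat F G where
  obj := pullbackLiftObj a b h
  map x y := pullbackHomLift (p := pullbackLiftObj a b h x) (q := pullbackLiftObj a b h y)
    (a.map x y) (b.map x y) (pullbackLift_condition a b h x y)
  map_id x := by
    refine pullbackHom_ext ?_ ?_
    · refine Eq.trans ?_ (pullbackHomLift_fst _ _ _).symm
      refine (Category.assoc _ _ _).trans ((congrArg _ (pullbackHomLift_fst _ _ _)).trans ?_)
      exact a.map_id x
    · refine Eq.trans ?_ (pullbackHomLift_snd _ _ _).symm
      refine (Category.assoc _ _ _).trans ((congrArg _ (pullbackHomLift_snd _ _ _)).trans ?_)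
      exact b.map_id x
  map_comp x y z := by
    have k1 (x y : T) : a.map x y = pullbackHomLift (p := pullbackLiftObj a b h x)
      (q := pullbackLiftObj a b h y) (a.map x y) (b.map x y) (pullbackLift_condition a b h x y) ≫
      pullbackHomFst _ _ := Eq.symm (by exact pullbackHomLift_fst _ _ _)
    have k2 (x y : T) : b.map x y = pullbackHomLift (p := pullbackLiftObj a b h x)
      (q := pullbackLiftObj a b h y) (a.map x y) (b.map x y) (pullbackLift_condition a b h x y) ≫
      pullbackHomSnd _ _ := Eq.symm (by exact pullbackHomLift_snd _ _ _)
    refine pullbackHom_ext ?_ ?_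
    · refine (Category.assoc _ _ _).trans ((congrArg _ (pullbackHomLift_fst _ _ _)).trans ?_)
      refine Eq.trans ?_ ((Category.assoc _ _ _).trans
        (congrArg _ (pullbackHomLift_fst _ _ _))).symm
      refine Eq.trans ?_ (tensorHom_comp_tensorHom_assoc _ _ _ _ _).symm
      exact (a.map_comp x y z).trans
        (congrArg₂ (fun s t ↦ (s ⊗ₘ t) ≫ eComp V _ _ _) (k1 x y) (k1 y z))
    · refine (Category.assoc _ _ _).trans ((congrArg _ (pullbackHomLift_snd _ _ _)).trans ?_)
      refine Eq.trans ?_ ((Category.assoc _ _ _).trans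
        (congrArg _ (pullbackHomLift_snd _ _ _))).symm
      refine Eq.trans ?_ (tensorHom_comp_tensorHom_assoc _ _ _ _ _).symm
      exact (b.map_comp x y z).trans
        (congrArg₂ (fun s t ↦ (s ⊗ₘ t) ≫ eComp V _ _ _) (k2 x y) (k2 y z))

variable {F G} in
lemma pullbackLift_fst {T : VCat.{w} V} (a : T ⟶ X) (b : T ⟶ Y) (h : a ≫ F = b ≫ G) :
    pullbackLift a b h ≫ pullbackFst F G = a :=
  EnrichedFunctor.ext V (fun _ ↦ rfl)
    (fun _ _ ↦ (Category.comp_id _).trans (pullbackHomLift_fst _ _ _))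

variable {F G} in
lemma pullbackLift_snd {T : VCat.{w} V} (a : T ⟶ X) (b : T ⟶ Y) (h : a ≫ F = b ≫ G) :
    pullbackLift a b h ≫ pullbackSnd F G = b :=
  EnrichedFunctor.ext V (fun _ ↦ rfl)
    (fun _ _ ↦ (Category.comp_id _).trans (pullbackHomLift_snd _ _ _))

variable {F G} in
lemma pullbackCat_hom_ext {T : VCat.{w} V} {m n : T ⟶ pullbackCat F G}
    (h₁ : m ≫ pullbackFst F G = n ≫ pullbackFst F G)
    (h₂ : m ≫ pullbackSnd F G = n ≫ pullbackSnd F G) : m = n := by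
  have h (x : T) : m.obj x = n.obj x :=
    Subtype.ext (Prod.ext (congr_obj h₁ x) (congr_obj h₂ x))
  refine EnrichedFunctor.ext V h (fun x y ↦ pullbackHom_ext ?_ ?_)
  · exact ((Category.assoc _ _ _).trans ((congrArg _
      (map_castHom (pullbackFst F G) (h x) (h y)).symm).trans (Category.assoc _ _ _).symm)).trans
      (congr_map h₁ x y)
  · exact ((Category.assoc _ _ _).trans ((congrArg _
      (map_castHom (pullbackSnd F G) (h x) (h y)).symm).trans (Category.assoc _ _ _).symm)).trans
      (congr_map h₂ x y)

lemma isPullback_pullbackCat : IsPullback (pullbackFst F G) (pullbackSnd F G) F G where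
  w := EnrichedFunctor.ext V (fun p ↦ p.2)
    (fun p q ↦ (Category.assoc _ _ _).trans (pullbackHom_condition p q))
  isLimit' := ⟨PullbackCone.IsLimit.mk _ (fun s ↦ pullbackLift s.fst s.snd s.condition)
    (fun _ ↦ pullbackLift_fst _ _ _) (fun _ ↦ pullbackLift_snd _ _ _)
    (fun _ _ h₁ h₂ ↦ pullbackCat_hom_ext (h₁.trans (pullbackLift_fst _ _ _).symm)
      (h₂.trans (pullbackLift_snd _ _ _).symm))⟩

instance : HasPullbacks (VCat.{w} V) :=
  have (X Y Z : VCat.{w} V) (F : X ⟶ Z) (G : Y ⟶ Z) : HasLimit (cospan F G) :=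
    (isPullback_pullbackCat F G).hasPullback
  hasPullbacks_of_hasLimit_cospan _

end VCat
end Enriched

section Lextensive

/-- A category is infinitary lextensive if it has finite limits and small coproducts and all
small coproducts are van Kampen, i.e. disjoint and stable under pullback. -/
class InfinitaryLextensive (V : Type u) [Category.{v} V] : Prop where
  [hasFiniteLimits : HasFiniteLimits V]
  [hasCoproducts : HasCoproducts.{v} V]
  isVanKampenColimit : ∀ {ι : Type v} {A : ι → V} (c : Cofan A),
    IsColimit c → IsVanKampenColimit c

attribute [instance] InfinitaryLextensive.hasFiniteLimits InfinitaryLextensive.hasCoproducts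

section
variable {V : Type u} [Category.{v} V] [CartesianMonoidalCategory V]

lemma isPullback_prod (A B : V) : IsPullback (fst A B) (snd A B) (toUnit A) (toUnit B) :=
  .of_is_product' (tensorProductIsBinaryProduct A B) isTerminalTensorUnit

lemma isPullback_whiskerLeft (A : V) {B C : V} (f : B ⟶ C) :
    IsPullback (A ◁ f) (snd A B) (snd A C) f := by
  refine IsPullback.of_right (h₁₂ := fst A C) (h₂₂ := toUnit C) ?_ (by simp)
    (isPullback_prod A C)
  simpa using (isPullback_prod A B)

end

section
variable {V : Type u} [Category.{v} V]

/-- A coproduct over a product is an iterated coproduct. -/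
lemma nonempty_isColimit_sigma {ι κ : Type*} {B : ι → κ → V} {c : Cofan fun p : ι × κ ↦ B p.1 p.2}
    (hc : IsColimit c) (d : ∀ i, Cofan (B i)) (hd : ∀ i, IsColimit (d i))
    (c' : Cofan fun i ↦ (d i).pt) (e : c'.pt = c.pt)
    (h : ∀ i k, (d i).inj k ≫ c'.inj i ≫ eqToHom e = c.inj (i, k)) : Nonempty (IsColimit c') := by
  obtain ⟨P, c'⟩ := c'
  obtain rfl : P = c.pt := e
  refine ⟨Cofan.IsColimit.mk _
    (fun t ↦ Cofan.IsColimit.desc hc fun p ↦ (d p.1).inj p.2 ≫ t.inj p.1) ?_ ?_⟩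
  · intro t i
    refine Cofan.IsColimit.hom_ext (hd i) _ _ fun k ↦ ?_
    have := h i k
    simp only [eqToHom_refl, Category.comp_id] at this
    rw [← Category.assoc, this, Cofan.IsColimit.fac]
  · intro t m hm
    refine Cofan.IsColimit.hom_ext hc _ _ fun p ↦ ?_
    have := h p.1 p.2
    simp only [eqToHom_refl, Category.comp_id] at this
    rw [Cofan.IsColimit.fac, ← hm, ← this, Category.assoc]

variable [InfinitaryLextensive V]

/-- The summands are the fibres of a coproduct of morphisms. -/
lemma isPullback_of_cofan {ι : Type v} {A B : ι → V} {c : Cofan A} (hc : IsColimit c)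
    {d : Cofan B} (hd : IsColimit d) (φ : ∀ i, A i ⟶ B i) (f : c.pt ⟶ d.pt)
    (h : ∀ i, c.inj i ≫ f = φ i ≫ d.inj i) (i : ι) :
    IsPullback (c.inj i) (φ i) f (d.inj i) :=
  (InfinitaryLextensive.isVanKampenColimit d hd c (Discrete.natTrans fun i ↦ φ i.as) f
    (by ext ⟨i⟩; exact (h i).symm) (NatTrans.Equifibered.of_discrete _)).1 ⟨hc⟩ ⟨i⟩

/-- Coproducts are stable under pullback. -/
lemma nonempty_isColimit_of_isPullback {ι : Type v} {A B : ι → V} {d : Cofan B}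
    (hd : IsColimit d) (φ : ∀ i, A i ⟶ B i) (c : Cofan A) (f : c.pt ⟶ d.pt)
    (h : ∀ i, IsPullback (c.inj i) (φ i) f (d.inj i)) : Nonempty (IsColimit c) :=
  (InfinitaryLextensive.isVanKampenColimit d hd c (Discrete.natTrans fun i ↦ φ i.as) f
    (by ext ⟨i⟩; exact (h i).w.symm) (NatTrans.Equifibered.of_discrete _)).2 (fun ⟨i⟩ ↦ h i)

end
end Lextensive

section Inclusion

section
variable {V : Type u} [Category.{v} V] [CartesianMonoidalCategory V] {X : VCat.{w} V}

namespace VCat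

lemma lift_eId_eComp {T : V} {x y : X} (f : T ⟶ (x ⟶[V] y)) :
    lift (toUnit T ≫ eId V x) f ≫ eComp V x x y = f := by
  have := f ≫= e_id_comp V x y
  rw [Category.comp_id, ← Category.assoc, ← Category.assoc] at this
  conv_rhs => rw [← this]
  congr 1
  ext <;> simp

lemma lift_eComp_eId {T : V} {x y : X} (f : T ⟶ (x ⟶[V] y)) :
    lift f (toUnit T ≫ eId V y) ≫ eComp V x y y = f := by
  have := f ≫= e_comp_id V x y
  rw [Category.comp_id, ← Category.assoc, ← Category.assoc] at this
  conv_rhs => rw [← this]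
  congr 1
  ext <;> simp

lemma lift_eComp_assoc {T : V} {x y z w : X} (f : T ⟶ (x ⟶[V] y)) (g : T ⟶ (y ⟶[V] z))
    (k : T ⟶ (z ⟶[V] w)) :
    lift (lift f g ≫ eComp V x y z) k ≫ eComp V x z w =
      lift f (lift g k ≫ eComp V y z w) ≫ eComp V x y w := by
  have := lift (lift f g) k ≫= (α_ _ _ _).hom ≫= e_assoc V x y z w
  rw [Iso.hom_inv_id_assoc, lift_whiskerRight_assoc, lift_lift_associator_hom_assoc,
    lift_whiskerLeft_assoc] at this
  exact this

end VCat
end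

variable {V : Type u} [Category.{v} V] [CartesianMonoidalCategory V] [InfinitaryLextensive V]

/-- The coproduct of copies of the unit object indexed by a set. -/
abbrev coprodUnit (X : Type v) : V := (sigmaConst.{v}.obj (𝟙_ V)).obj X

/-- The injections of the coproduct of copies of the unit object. -/
def pt {X : Type v} (x : X) : 𝟙_ V ⟶ coprodUnit X := Sigma.ι (fun _ : X ↦ 𝟙_ V) x

namespace VCat
variable (X : VCat.{v} V)

/-- The coproduct of the hom-objects of a `V`-category. -/
abbrev homs : V := ∐ fun p : X × X ↦ (p.1 ⟶[V] p.2)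

variable {X} in
/-- The injections of the coproduct of the hom-objects. -/
def inc (x y : X) : (x ⟶[V] y) ⟶ X.homs := Sigma.ι (fun p : X × X ↦ (p.1 ⟶[V] p.2)) (x, y)

/-- The source. -/
def src : X.homs ⟶ coprodUnit X := Sigma.desc fun p ↦ toUnit _ ≫ pt p.1

/-- The target. -/
def tgt : X.homs ⟶ coprodUnit X := Sigma.desc fun p ↦ toUnit _ ≫ pt p.2

/-- The identities. -/
def ident : coprodUnit X ⟶ X.homs := Sigma.desc fun x ↦ eId V x ≫ inc x x

variable {X}

@[simp] lemma inc_src (x y : X) : inc x y ≫ X.src = toUnit _ ≫ pt x := Sigma.ι_desc _ _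
@[simp] lemma inc_tgt (x y : X) : inc x y ≫ X.tgt = toUnit _ ≫ pt y := Sigma.ι_desc _ _
@[simp] lemma pt_ident (x : X) : pt x ≫ X.ident = eId V x ≫ inc x x := Sigma.ι_desc _ _

lemma isPullback_src (x : X) :
    IsPullback (Sigma.desc fun y ↦ inc x y) (toUnit (∐ fun y : X ↦ (x ⟶[V] y))) X.src (pt x) := by
  let c : Cofan fun x : X ↦ ∐ fun y : X ↦ (x ⟶[V] y) :=
    Cofan.mk X.homs fun x ↦ Sigma.desc fun y ↦ inc x y
  obtain ⟨hc⟩ : Nonempty (IsColimit c) := nonempty_isColimit_sigma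
    (coproductIsCoproduct fun p : X × X ↦ (p.1 ⟶[V] p.2)) _
    (fun x ↦ coproductIsCoproduct fun y : X ↦ (x ⟶[V] y)) c rfl (fun x y ↦ by
      simp [c, inc])
  exact isPullback_of_cofan hc (coproductIsCoproduct fun _ : X ↦ 𝟙_ V) (fun _ ↦ toUnit _) X.src
    (fun x ↦ Sigma.hom_ext _ _ fun y ↦ by simp [c, pt]) x

/-- The pullback of the source map along a morphism from a coproduct, whose restriction to
each summand is constant. -/
lemma nonempty_isColimit_pullback {β : Type v} {A : β → V} {c : Cofan A} (hc : IsColimit c)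
    (a : c.pt ⟶ coprodUnit X) (q : β → X) (ha : ∀ j, c.inj j ≫ a = toUnit _ ≫ pt (q j)) :
    Nonempty (IsColimit (Cofan.mk (pullback a X.src) fun p : β × X ↦
      pullback.lift (fst (A p.1) (q p.1 ⟶[V] p.2) ≫ c.inj p.1) (snd _ _ ≫ inc (q p.1) p.2)
        (by simp [ha]))) := by
  have e (j : β) : IsPullback (snd (A j) (∐ fun y ↦ (q j ⟶[V] y)) ≫ Sigma.desc fun y ↦ inc (q j) y)
      (fst _ _) X.src (c.inj j ≫ a) := by
    rw [ha]
    exact (isPullback_prod _ _).flip.paste_horiz (isPullback_src (q j))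
  let l (j : β) : A j ⊗ (∐ fun y ↦ (q j ⟶[V] y)) ⟶ pullback a X.src :=
    pullback.lift (fst _ _ ≫ c.inj j) (snd _ _ ≫ Sigma.desc fun y ↦ inc (q j) y)
      (by rw [(e j).w, Category.assoc])
  let d (j : β) : Cofan fun y ↦ A j ⊗ (q j ⟶[V] y) :=
    Cofan.mk (A j ⊗ ∐ fun y ↦ (q j ⟶[V] y)) fun y ↦ A j ◁ Sigma.ι (fun y ↦ (q j ⟶[V] y)) y
  have hd (j : β) : Nonempty (IsColimit (d j)) :=
    nonempty_isColimit_of_isPullback (coproductIsCoproduct fun y ↦ (q j ⟶[V] y))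
      (fun y ↦ snd _ _) (d j) (snd _ _) (fun y ↦ isPullback_whiskerLeft _ _)
  obtain ⟨hl⟩ := nonempty_isColimit_of_isPullback hc (fun j ↦ fst _ _)
    (Cofan.mk (pullback a X.src) l) (pullback.fst a X.src) (fun j ↦ IsPullback.of_right
      (h₁₂ := pullback.snd a X.src) (v₁₃ := X.src) (h₂₂ := a)
      (by simpa [l, pullback.lift_snd] using e j) (pullback.lift_fst _ _ _)
      (IsPullback.of_hasPullback a X.src).flip)
  refine ⟨IsColimit.ofIsoColimit
    (Cofan.IsColimit.prod d (fun j ↦ (hd j).some) (Cofan.mk (pullback a X.src) l) hl)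
    (Cofan.ext (Iso.refl _) fun p ↦ ?_)⟩
  refine pullback.hom_ext ?_ ?_
  · simp [d, l, pullback.lift_fst]
  · simp [d, l, pullback.lift_snd]

variable (X)

/-- The coproduct of the hom-objects is a coproduct of the hom-objects. -/
def isColimitHoms : IsColimit (Cofan.mk X.homs fun p : X × X ↦ inc p.1 p.2) :=
  coproductIsCoproduct fun p : X × X ↦ (p.1 ⟶[V] p.2)

/-- The object of composable pairs is the coproduct of the objects
`(x ⟶[V] y) ⊗ (y ⟶[V] z)`. -/
def isColimitPairs : IsColimit (Cofan.mk (pullback X.tgt X.src) fun p : (X × X) × X ↦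
    pullback.lift (fst (p.1.1 ⟶[V] p.1.2) (p.1.2 ⟶[V] p.2) ≫ inc p.1.1 p.1.2)
      (snd _ _ ≫ inc p.1.2 p.2) (by simp)) :=
  (nonempty_isColimit_pullback X.isColimitHoms X.tgt Prod.snd (fun _ ↦ inc_tgt _ _)).some

/-- The composition. -/
def comp : pullback X.tgt X.src ⟶ X.homs :=
  Cofan.IsColimit.desc X.isColimitPairs fun p ↦ eComp V p.1.1 p.1.2 p.2 ≫ inc p.1.1 p.2

variable {X}

@[simp] lemma lift_comp {T : V} {x y z : X} (f : T ⟶ (x ⟶[V] y)) (g : T ⟶ (y ⟶[V] z)) :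
    pullback.lift (f ≫ inc x y) (g ≫ inc y z) (by simp) ≫ X.comp =
      lift f g ≫ eComp V x y z ≫ inc x z := by
  have := Cofan.IsColimit.fac X.isColimitPairs
    (fun p ↦ eComp V p.1.1 p.1.2 p.2 ≫ inc p.1.1 p.2) ((x, y), z)
  rw [← comp] at this
  dsimp at this
  rw [← this]
  refine Eq.trans ?_ (Category.assoc _ _ _)
  congr 1
  refine pullback.hom_ext ?_ ?_ <;> simp [pullback.lift_fst, pullback.lift_snd]

lemma coprodUnit_hom_ext {X : Type v} {W : V} {f g : coprodUnit X ⟶ W}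
    (h : ∀ x, pt x ≫ f = pt x ≫ g) : f = g := Sigma.hom_ext _ _ h

lemma homs_hom_ext {W : V} {f g : X.homs ⟶ W} (h : ∀ x y, inc x y ≫ f = inc x y ≫ g) : f = g :=
  Sigma.hom_ext _ _ fun _ ↦ h _ _

lemma pairs_hom_ext {W : V} {f g : pullback X.tgt X.src ⟶ W}
    (h : ∀ x y z : X,
      pullback.lift (fst (x ⟶[V] y) (y ⟶[V] z) ≫ inc x y) (snd _ _ ≫ inc y z) (by simp) ≫ f =
      pullback.lift (fst (x ⟶[V] y) (y ⟶[V] z) ≫ inc x y) (snd _ _ ≫ inc y z) (by simp) ≫ g) :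
    f = g :=
  Cofan.IsColimit.hom_ext X.isColimitPairs _ _ fun _ ↦ h _ _ _

lemma triples_hom_ext {W : V} {f g : pullback (pullback.snd X.tgt X.src ≫ X.tgt) X.src ⟶ W}
    (h : ∀ (x y z w : X) (T : V) (a : T ⟶ (x ⟶[V] y)) (b : T ⟶ (y ⟶[V] z)) (c : T ⟶ (z ⟶[V] w)),
      pullback.lift (pullback.lift (a ≫ inc x y) (b ≫ inc y z) (by simp)) (c ≫ inc z w)
        (by simp [pullback.lift_snd_assoc]) ≫ f =
      pullback.lift (pullback.lift (a ≫ inc x y) (b ≫ inc y z) (by simp)) (c ≫ inc z w)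
        (by simp [pullback.lift_snd_assoc]) ≫ g) : f = g := by
  refine Cofan.IsColimit.hom_ext (nonempty_isColimit_pullback X.isColimitPairs
    (pullback.snd X.tgt X.src ≫ X.tgt) Prod.snd
    (fun _ ↦ by simp [pullback.lift_snd_assoc])).some _ _ fun ⟨⟨⟨x, y⟩, z⟩, w⟩ ↦ ?_
  have h' := h x y z w _ (fst ((x ⟶[V] y) ⊗ (y ⟶[V] z)) (z ⟶[V] w) ≫ fst _ _)
    (fst ((x ⟶[V] y) ⊗ (y ⟶[V] z)) (z ⟶[V] w) ≫ snd _ _) (snd _ _)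
  have e : pullback.lift (f := pullback.snd X.tgt X.src ≫ X.tgt) (g := X.src)
      (fst ((x ⟶[V] y) ⊗ (y ⟶[V] z)) (z ⟶[V] w) ≫
        pullback.lift (fst (x ⟶[V] y) (y ⟶[V] z) ≫ inc x y) (snd _ _ ≫ inc y z) (by simp))
      (snd _ _ ≫ inc z w) (by simp [pullback.lift_snd_assoc]) = pullback.lift
        (pullback.lift ((fst ((x ⟶[V] y) ⊗ (y ⟶[V] z)) (z ⟶[V] w) ≫ fst _ _) ≫ inc x y)
          ((fst _ _ ≫ snd _ _) ≫ inc y z) (by simp)) (snd _ _ ≫ inc z w)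
            (by simp [pullback.lift_snd_assoc]) := by
    refine pullback.hom_ext (pullback.hom_ext ?_ ?_) ?_ <;>
      simp [pullback.lift_snd, pullback.lift_fst]
  exact (congrArg (· ≫ f) e).trans (h'.trans (congrArg (· ≫ g) e.symm))

end VCat

/-- The internal category associated to a small `V`-category `X`: the object of objects is the
coproduct of copies of the unit object indexed by the objects of `X`, and the object of arrows
is the coproduct of the hom-objects of `X`. -/
def VCat.toInternalCat (X : VCat.{v} V) : InternalCat V where
  obj := coprodUnit X
  arr := X.homs
  src := X.src
  tgt := X.tgt
  ident := X.ident
  comp := X.comp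
  ident_src := VCat.coprodUnit_hom_ext fun x ↦ by
    rw [reassoc_of% (VCat.pt_ident x)]; simp
  ident_tgt := VCat.coprodUnit_hom_ext fun x ↦ by
    rw [reassoc_of% (VCat.pt_ident x)]; simp
  comp_src := VCat.pairs_hom_ext fun x y z ↦ by
    rw [reassoc_of% (VCat.lift_comp)]; simp [pullback.lift_fst_assoc]
  comp_tgt := VCat.pairs_hom_ext fun x y z ↦ by
    rw [reassoc_of% (VCat.lift_comp)]; simp [pullback.lift_snd_assoc]
  id_comp := VCat.homs_hom_ext fun x y ↦ by
    have := VCat.lift_comp (toUnit _ ≫ eId V x) (𝟙 (x ⟶[V] y))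
    rw [reassoc_of% VCat.lift_eId_eComp] at this
    refine Eq.trans ?_ (this.trans (by simp))
    refine (Category.assoc _ _ _).symm.trans ?_
    congr 1
    refine pullback.hom_ext ?_ ?_ <;>
      simp [pullback.lift_fst, pullback.lift_snd, reassoc_of% @VCat.inc_src]
  comp_id := VCat.homs_hom_ext fun x y ↦ by
    have := VCat.lift_comp (𝟙 (x ⟶[V] y)) (toUnit _ ≫ eId V y)
    rw [reassoc_of% VCat.lift_eComp_eId] at this
    refine Eq.trans ?_ (this.trans (by simp))
    refine (Category.assoc _ _ _).symm.trans ?_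
    congr 1
    refine pullback.hom_ext ?_ ?_ <;>
      simp [pullback.lift_fst, pullback.lift_snd, reassoc_of% @VCat.inc_tgt]
  assoc := VCat.triples_hom_ext fun x y z w T a b c ↦ by
    have h₁ := VCat.lift_comp (lift a b ≫ eComp V x y z) c
    have h₂ := VCat.lift_comp a (lift b c ≫ eComp V y z w)
    rw [reassoc_of% VCat.lift_eComp_assoc] at h₁
    refine Eq.trans ((Category.assoc _ _ _).symm.trans ?_)
      ((h₁.trans h₂.symm).trans (Eq.trans ?_ (Category.assoc _ _ _)))
    · congr 1
      refine pullback.hom_ext ?_ ?_ <;> simp only [Category.assoc, pullback.lift_fst,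
        pullback.lift_snd, pullback.lift_fst_assoc, VCat.lift_comp]
    · congr 1
      refine pullback.hom_ext ?_ ?_ <;> simp only [Category.assoc, pullback.lift_fst,
        pullback.lift_snd, pullback.lift_fst_assoc]
      refine (VCat.lift_comp b c).symm.trans (Eq.trans ?_ (Category.assoc _ _ _))
      congr 1
      refine pullback.hom_ext ?_ ?_ <;> simp only [Category.assoc, pullback.lift_fst,
        pullback.lift_snd, pullback.lift_fst_assoc]

namespace VCat
variable {X Y : VCat.{v} V} (F : X ⟶ Y)

/-- The action of a `V`-functor on the object of objects. -/
def mapObj : coprodUnit (V := V) X ⟶ coprodUnit Y := Sigma.desc fun x ↦ pt (F.obj x)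

/-- The action of a `V`-functor on the object of arrows. -/
def mapHoms : X.homs ⟶ Y.homs :=
  Sigma.desc fun p ↦ F.map p.1 p.2 ≫ inc (F.obj p.1) (F.obj p.2)

@[simp] lemma pt_mapObj (x : X) : pt x ≫ mapObj F = pt (F.obj x) := Sigma.ι_desc _ _

@[simp] lemma inc_mapHoms (x y : X) :
    inc x y ≫ mapHoms F = F.map x y ≫ inc (F.obj x) (F.obj y) := Sigma.ι_desc _ _

lemma mapHoms_src : mapHoms F ≫ Y.src = X.src ≫ mapObj F := homs_hom_ext fun x y ↦ by
  simp [reassoc_of% @inc_mapHoms, reassoc_of% @inc_src]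

lemma mapHoms_tgt : mapHoms F ≫ Y.tgt = X.tgt ≫ mapObj F := homs_hom_ext fun x y ↦ by
  simp [reassoc_of% @inc_mapHoms, reassoc_of% @inc_tgt]

lemma ident_mapHoms : X.ident ≫ mapHoms F = mapObj F ≫ Y.ident := coprodUnit_hom_ext fun x ↦ by
  simp [reassoc_of% @pt_mapObj, reassoc_of% @pt_ident]

lemma comp_mapHoms : X.comp ≫ mapHoms F = pullback.lift (pullback.fst X.tgt X.src ≫ mapHoms F)
    (pullback.snd X.tgt X.src ≫ mapHoms F)
    (by rw [Category.assoc, Category.assoc, mapHoms_src, mapHoms_tgt, pullback.condition_assoc]) ≫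
      Y.comp := pairs_hom_ext fun x y z ↦ by
  have h₁ := lift_comp (fst (x ⟶[V] y) (y ⟶[V] z)) (snd _ _) =≫ mapHoms F
  have h₂ := lift_comp (fst (x ⟶[V] y) (y ⟶[V] z) ≫ F.map x y) (snd _ _ ≫ F.map y z)
  refine Eq.trans ((Category.assoc _ _ _).symm.trans (h₁.trans ?_))
    (h₂.symm.trans (Eq.trans ?_ (Category.assoc _ _ _)))
  · simp
  · congr 1
    refine pullback.hom_ext ?_ ?_ <;> simp [pullback.lift_fst, pullback.lift_snd,
      pullback.lift_fst_assoc, pullback.lift_snd_assoc]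

lemma mapObj_id : mapObj (𝟙 X) = 𝟙 _ := coprodUnit_hom_ext fun x ↦ by simp

lemma mapHoms_id : mapHoms (𝟙 X) = 𝟙 _ := homs_hom_ext fun x y ↦ by simp

lemma mapObj_comp {Z : VCat.{v} V} (G : Y ⟶ Z) : mapObj (F ≫ G) = mapObj F ≫ mapObj G :=
  coprodUnit_hom_ext fun x ↦ by simp [reassoc_of% @pt_mapObj]

lemma mapHoms_comp {Z : VCat.{v} V} (G : Y ⟶ Z) : mapHoms (F ≫ G) = mapHoms F ≫ mapHoms G :=
  homs_hom_ext fun x y ↦ by simp [reassoc_of% @inc_mapHoms]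

end VCat

variable (V) in
/-- The inclusion of the category of small `V`-categories into the category of internal
categories in `V`. -/
def inclusion : VCat.{v} V ⥤ InternalCat V where
  obj X := X.toInternalCat
  map F :=
    { obj := VCat.mapObj F
      arr := VCat.mapHoms F
      arr_src := VCat.mapHoms_src F
      arr_tgt := VCat.mapHoms_tgt F
      ident_arr := VCat.ident_mapHoms F
      comp_arr := VCat.comp_mapHoms F }
  map_id _ := InternalCat.hom_ext VCat.mapObj_id VCat.mapHoms_id
  map_comp F G := InternalCat.hom_ext (VCat.mapObj_comp F G) (VCat.mapHoms_comp F G)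

end Inclusion
end EnrichedDescent

end

/-! Effective descent is first made elementary. A descent datum on `d : X ⟶ E` is the same as a
natural rule moving a generalized element of `X` to any other point of `E` in the same fibre of `p`
(`DescentAction`). The comparison functor is then an equivalence exactly when two conditions hold:
maps out of a pullback of `p` that identify elements with equal image descend uniquely
(`DescendsMorphisms`), and every action comes from a pullback square (`DescendsObjects`).

Both conditions can be compared along the inclusion `ι`. It is fully faithful: full faithfulness of
`J` identifies maps on objects with functions, and extensivity recovers `X(x,y)` as the fibre of
source and target over `x` and `y`. It preserves pullbacks: a pullback of coproducts is the
coproduct of the pullbacks of the summands, and those over a pair of indices with different images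
are initial, so only the fibre product of the index sets remains. Hence descent of morphisms for
`ι(p)` gives descent of morphisms for `p`. An action in `V`-Cat also gives one in Cat(`V`), because
by naturality it is determined by one map out of `X ×_B E`. Descent in Cat(`V`) then yields a
pullback square with some internal category `A` over `ι(B)`. What is left is to show that `A` lies
in the essential image of `ι`.

Two facts settle this. First, `p` is surjective on objects: the full subcategory on the objects
missed by `p` pulls back to the empty category, and descent of morphisms would map this subcategory
to an empty one. Secondly, an internal category whose object of objects is a coproduct of copies of
the unit is in the image, since extensivity splits its arrows into hom-objects. A section of `p` on
objects exhibits the object of objects of `A` as the pullback of a map between such coproducts along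
another, so it is itself such a coproduct. -/

noncomputable section

namespace EnrichedDescent

/-! ### Generalized elements in the basic fibration -/

section Elements
variable {C : Type u} [Category.{v} C] [HasPullbacks C]

/-- A morphism between pulled back objects, evaluated at a generalized element. -/
def elt {Y X₁ X₂ : C} {f₁ : Y ⟶ X₁} {f₂ : Y ⟶ X₂} {M₁ : Over X₁} {M₂ : Over X₂}
    (φ : (baseChange f₁).obj M₁ ⟶ (baseChange f₂).obj M₂) {T : C} (x : T ⟶ M₁.left) (y : T ⟶ Y)
    (h : x ≫ M₁.hom = y ≫ f₁) : T ⟶ M₂.left :=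
  baseChangeLift f₁ M₁ x y h ≫ φ.left ≫ baseChangeFst f₂ M₂

lemma comp_baseChangeLift {E B : C} (p : E ⟶ B) (A : Over B) {T T' : C} (t : T' ⟶ T)
    (a : T ⟶ A.left) (e : T ⟶ E) (h : a ≫ A.hom = e ≫ p) :
    t ≫ baseChangeLift p A a e h = baseChangeLift p A (t ≫ a) (t ≫ e) (by simp [h]) :=
  baseChange_hom_ext _ _ (by simp) (by simp)

lemma baseChangeLift_comp_left {Y X₁ X₂ : C} {f₁ : Y ⟶ X₁} {f₂ : Y ⟶ X₂} {M₁ : Over X₁}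
    {M₂ : Over X₂} (φ : (baseChange f₁).obj M₁ ⟶ (baseChange f₂).obj M₂) {T : C}
    (x : T ⟶ M₁.left) (y : T ⟶ Y) (h : x ≫ M₁.hom = y ≫ f₁)
    (h' : elt φ x y h ≫ M₂.hom = y ≫ f₂) :
    baseChangeLift f₁ M₁ x y h ≫ φ.left = baseChangeLift f₂ M₂ (elt φ x y h) y h' :=
  baseChange_hom_ext _ _ (by simp [elt]) (by simp)

section
variable {Y X₁ X₂ : C} {f₁ : Y ⟶ X₁} {f₂ : Y ⟶ X₂} {M₁ : Over X₁} {M₂ : Over X₂}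
    (φ : (baseChange f₁).obj M₁ ⟶ (baseChange f₂).obj M₂)

lemma elt_hom {T : C} (x : T ⟶ M₁.left) (y : T ⟶ Y) (h : x ≫ M₁.hom = y ≫ f₁) :
    elt φ x y h ≫ M₂.hom = y ≫ f₂ := by
  simp [elt, baseChangeFst_condition]

lemma comp_elt {T T' : C} (t : T' ⟶ T) (x : T ⟶ M₁.left) (y : T ⟶ Y)
    (h : x ≫ M₁.hom = y ≫ f₁) :
    t ≫ elt φ x y h = elt φ (t ≫ x) (t ≫ y) (by simp [h]) := by
  rw [elt, ← Category.assoc, comp_baseChangeLift, elt]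

lemma elt_congr {T : C} {x x' : T ⟶ M₁.left} {y y' : T ⟶ Y} (hx : x = x') (hy : y = y')
    (h : x ≫ M₁.hom = y ≫ f₁) : elt φ x y h = elt φ x' y' (by rw [← hx, ← hy, h]) := by
  subst hx hy; rfl

variable {φ} in
-- The Yoneda lemma: the pair of projections of the pullback is the generic element, and on it `elt`
-- returns the projection of the morphism itself.
lemma elt_ext {ψ : (baseChange f₁).obj M₁ ⟶ (baseChange f₂).obj M₂}
    (H : ∀ ⦃T : C⦄ (x : T ⟶ M₁.left) (y : T ⟶ Y) (h : x ≫ M₁.hom = y ≫ f₁),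
      elt φ x y h = elt ψ x y h) : φ = ψ := by
  have e : baseChangeLift f₁ M₁ (baseChangeFst f₁ M₁) ((baseChange f₁).obj M₁).hom
      (baseChangeFst_condition _ _) = 𝟙 _ := baseChange_hom_ext _ _ (by simp) (by simp)
  refine Over.OverMorphism.ext (baseChange_hom_ext _ _ ?_ ((Over.w _).trans (Over.w _).symm))
  have := H (baseChangeFst f₁ M₁) _ (baseChangeFst_condition f₁ M₁)
  simpa only [elt, e, Category.id_comp] using this

lemma elt_id {T : C} (x : T ⟶ M₁.left) (y : T ⟶ Y) (h : x ≫ M₁.hom = y ≫ f₁) :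
    elt (𝟙 ((baseChange f₁).obj M₁)) x y h = x := by
  simp [elt]

lemma elt_comp {X₃ : C} {f₃ : Y ⟶ X₃} {M₃ : Over X₃}
    (ψ : (baseChange f₂).obj M₂ ⟶ (baseChange f₃).obj M₃)
    {T : C} (x : T ⟶ M₁.left) (y : T ⟶ Y) (h : x ≫ M₁.hom = y ≫ f₁) :
    elt (φ ≫ ψ) x y h = elt ψ (elt φ x y h) y (elt_hom _ _ _ _) := by
  have := baseChangeLift_comp_left φ x y h (elt_hom _ _ _ _) =≫ (ψ.left ≫ baseChangeFst f₃ M₃)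
  simpa [elt] using this

lemma elt_map {X Y : C} {f : Y ⟶ X} {M M' : Over X} (φ : M ⟶ M') {T : C} (x : T ⟶ M.left)
    (y : T ⟶ Y) (h : x ≫ M.hom = y ≫ f) : elt ((baseChange f).map φ) x y h = x ≫ φ.left := by
  simp [elt]

lemma elt_map_comp {M₁' : Over X₁} (ψ : M₁' ⟶ M₁) {T : C} (x : T ⟶ M₁'.left) (y : T ⟶ Y)
    (h : x ≫ M₁'.hom = y ≫ f₁) :
    elt ((baseChange f₁).map ψ ≫ φ) x y h = elt φ (x ≫ ψ.left) y (by simpa using h) :=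
  (elt_comp _ _ _ _ _).trans (elt_congr _ (elt_map _ _ _ _) rfl _)

lemma elt_comp_map {M₂' : Over X₂} (ψ : M₂ ⟶ M₂') {T : C} (x : T ⟶ M₁.left) (y : T ⟶ Y)
    (h : x ≫ M₁.hom = y ≫ f₁) :
    elt (φ ≫ (baseChange f₂).map ψ) x y h = elt φ x y h ≫ ψ.left :=
  (elt_comp _ _ _ _ _).trans (elt_map _ _ _ _)

/-- A morphism of pulled back objects from its action on generalized elements. -/
lemma elt_homMk (α : ((baseChange f₁).obj M₁).left ⟶ M₂.left)
    (hα : α ≫ M₂.hom = ((baseChange f₁).obj M₁).hom ≫ f₂) {T : C} (x : T ⟶ M₁.left) (y : T ⟶ Y)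
    (h : x ≫ M₁.hom = y ≫ f₁) :
    elt (Over.homMk (baseChangeLift f₂ M₂ α _ hα) (by simp) :
      (baseChange f₁).obj M₁ ⟶ (baseChange f₂).obj M₂) x y h = baseChangeLift f₁ M₁ x y h ≫ α := by
  simp [elt]

end

/-- The coherence isomorphisms of the basic fibration are determined by their projections to the
base and to the total object. This fact and its companion for the inverse are all that the later
arguments need about them. -/
lemma mapComp'_hom_left_fst_fst {X Y Y' : C} (f : Y ⟶ X) (g : Y' ⟶ Y) (gf : Y' ⟶ X)
    (h : f.op.toLoc ≫ g.op.toLoc = gf.op.toLoc) (M : Over X) :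
    CommaMorphism.left (((basicFibration C).mapComp' f.op.toLoc g.op.toLoc gf.op.toLoc
      h).hom.toNatTrans.app M) ≫ baseChangeFst g ((baseChange f).obj M) ≫ baseChangeFst f M =
      baseChangeFst gf M := by
  obtain rfl : g ≫ f = gf := by
    have := congrArg (fun k ↦ k.as.unop) h
    exact this
  have e : (basicFibration C).mapComp' f.op.toLoc g.op.toLoc (g ≫ f).op.toLoc h =
    (basicFibration C).mapComp f.op.toLoc g.op.toLoc := Pseudofunctor.mapComp'_eq_mapComp _ _ _
  rw [e]
  exact baseChangeComp_hom_app_left_fst_fst g f M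

lemma mapComp'_inv_left_fst {X Y Y' : C} (f : Y ⟶ X) (g : Y' ⟶ Y) (gf : Y' ⟶ X)
    (h : f.op.toLoc ≫ g.op.toLoc = gf.op.toLoc) (M : Over X) :
    CommaMorphism.left (((basicFibration C).mapComp' f.op.toLoc g.op.toLoc gf.op.toLoc
      h).inv.toNatTrans.app M) ≫ baseChangeFst gf M =
      baseChangeFst g ((baseChange f).obj M) ≫ baseChangeFst f M := by
  obtain rfl : g ≫ f = gf := by
    have := congrArg (fun k ↦ k.as.unop) h
    exact this
  have e : (basicFibration C).mapComp' f.op.toLoc g.op.toLoc (g ≫ f).op.toLoc h =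
    (basicFibration C).mapComp f.op.toLoc g.op.toLoc := Pseudofunctor.mapComp'_eq_mapComp _ _ _
  rw [e]
  exact baseChangeComp_inv_app_left_fst g f M

/-- The isomorphisms `α` and `β` do not move the component in `M₁` or `M₂`, so conjugating by them
only replaces the point `y` by `y ≫ g`. They are kept abstract, known only through their
projections, so that no coherence data has to be unfolded. -/
lemma elt_conj {X₁ X₂ Y Y' : C} {f₁ : Y ⟶ X₁} {f₂ : Y ⟶ X₂} {M₁ : Over X₁} {M₂ : Over X₂}
    (φ : (baseChange f₁).obj M₁ ⟶ (baseChange f₂).obj M₂) (g : Y' ⟶ Y) {gf₁ : Y' ⟶ X₁}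
    {gf₂ : Y' ⟶ X₂} (h₁ : g ≫ f₁ = gf₁)
    (α : (baseChange gf₁).obj M₁ ⟶ (baseChange g).obj ((baseChange f₁).obj M₁))
    (hα : α.left ≫ baseChangeFst g _ ≫ baseChangeFst f₁ M₁ = baseChangeFst gf₁ M₁)
    (β : (baseChange g).obj ((baseChange f₂).obj M₂) ⟶ (baseChange gf₂).obj M₂)
    (hβ : β.left ≫ baseChangeFst gf₂ M₂ = baseChangeFst g _ ≫ baseChangeFst f₂ M₂)
    {T : C} (x : T ⟶ M₁.left) (y : T ⟶ Y') (h : x ≫ M₁.hom = y ≫ gf₁) :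
    elt (α ≫ (baseChange g).map φ ≫ β) x y h = elt φ x (y ≫ g) (by simp [h, h₁]) := by
  simp only [elt, Over.comp_left, Category.assoc, hβ, baseChange_map_left_fst_assoc]
  rw [← Category.assoc α.left, ← Category.assoc (baseChangeLift _ _ _ _ _)]
  congr 1
  refine baseChange_hom_ext _ _ (by simp [hα]) ?_
  rw [baseChangeLift_hom, Category.assoc, Category.assoc, baseChangeFst_condition g,
    reassoc_of% (Over.w α), baseChangeLift_hom_assoc]

lemma elt_pullHom {X₁ X₂ Y Y' : C} {f₁ : Y ⟶ X₁} {f₂ : Y ⟶ X₂} {M₁ : Over X₁} {M₂ : Over X₂}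
    (φ : (baseChange f₁).obj M₁ ⟶ (baseChange f₂).obj M₂) (g : Y' ⟶ Y) (gf₁ : Y' ⟶ X₁)
    (gf₂ : Y' ⟶ X₂) (h₁ : g ≫ f₁ = gf₁) (h₂ : g ≫ f₂ = gf₂) {T : C} (x : T ⟶ M₁.left)
    (y : T ⟶ Y') (h : x ≫ M₁.hom = y ≫ gf₁) :
    elt (f₁ := gf₁) (f₂ := gf₂) (Pseudofunctor.LocallyDiscreteOpToCat.pullHom
      (F := basicFibration C) (M₁ := M₁) (M₂ := M₂) φ g gf₁ gf₂ h₁ h₂) x y h =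
      elt φ x (y ≫ g) (by simp [h, h₁]) :=
  elt_conj φ g h₁ _ (mapComp'_hom_left_fst_fst f₁ g gf₁ _ M₁) _
    (mapComp'_inv_left_fst f₂ g gf₂ _ M₂) x y h

lemma elt_comp_fst {E B Y : C} {p : E ⟶ B} {A : Over B} {q : Y ⟶ B} {f₁ f₂ : Y ⟶ E}
    (α : (baseChange f₁).obj ((baseChange p).obj A) ⟶ (baseChange q).obj A)
    (hα : α.left ≫ baseChangeFst q A = baseChangeFst f₁ _ ≫ baseChangeFst p A)
    (β : (baseChange q).obj A ⟶ (baseChange f₂).obj ((baseChange p).obj A))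
    (hβ : β.left ≫ baseChangeFst f₂ _ ≫ baseChangeFst p A = baseChangeFst q A)
    {T : C} (x : T ⟶ ((baseChange p).obj A).left)
    (y : T ⟶ Y) (h : x ≫ ((baseChange p).obj A).hom = y ≫ f₁) :
    elt (α ≫ β) x y h ≫ baseChangeFst p A = x ≫ baseChangeFst p A := by
  simp [elt, hβ, hα]

/-- The canonical descent datum on `p^* A` sends `(a, e)` to `(a, e')`: it is a composite of
coherence isomorphisms, neither of which moves the component in `A`. -/
lemma elt_ofObj {E B Y : C} (p : E ⟶ B) (A : Over B) (q : Y ⟶ B) (f₁ f₂ : Y ⟶ E)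
    (h₁ : f₁ ≫ p = q) (h₂ : f₂ ≫ p = q) {T : C} (x : T ⟶ ((baseChange p).obj A).left)
    (y : T ⟶ Y) (h : x ≫ ((baseChange p).obj A).hom = y ≫ f₁) :
    elt (f₁ := f₁) (f₂ := f₂) (M₁ := (baseChange p).obj A) (M₂ := (baseChange p).obj A)
      ((Pseudofunctor.DescentData.ofObj (F := basicFibration C) (f := fun _ : PUnit.{1} ↦ p)
      A).hom q (i₁ := ⟨⟩) (i₂ := ⟨⟩) f₁ f₂ h₁ h₂) x y h ≫ baseChangeFst p A =
      x ≫ baseChangeFst p A :=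
  elt_comp_fst _ (mapComp'_inv_left_fst p f₁ q _ A) _ (mapComp'_hom_left_fst_fst p f₂ q _ A) x y h

end Elements

/-! ### Descent data as actions on generalized elements -/

section Descent
variable {C : Type u} [Category.{v} C]

/-- A descent datum on `d : X ⟶ E` relative to `p : E ⟶ B`, in terms of generalized elements:
an element of `X` may be transported along the fibres of `p`. -/
structure DescentAction {E B : C} (p : E ⟶ B) {X : C} (d : X ⟶ E) where
  /-- The transport of an element `x` of `X` to the fibre over `e`. -/
  act ⦃T : C⦄ (x : T ⟶ X) (e : T ⟶ E) (h : x ≫ d ≫ p = e ≫ p) : T ⟶ X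
  comp_act ⦃T' T : C⦄ (t : T' ⟶ T) (x : T ⟶ X) (e : T ⟶ E) (h : x ≫ d ≫ p = e ≫ p) :
    t ≫ act x e h = act (t ≫ x) (t ≫ e) (by simp [h])
  act_comp ⦃T : C⦄ (x : T ⟶ X) (e : T ⟶ E) (h : x ≫ d ≫ p = e ≫ p) : act x e h ≫ d = e
  act_self ⦃T : C⦄ (x : T ⟶ X) : act x (x ≫ d) (by simp) = x
  act_act ⦃T : C⦄ (x : T ⟶ X) (e e' : T ⟶ E) (h : x ≫ d ≫ p = e ≫ p) (h' : e ≫ p = e' ≫ p) :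
    act (act x e h) e' (by rw [reassoc_of% (act_comp x e h), h']) = act x e' (h.trans h')

lemma DescentAction.act_congr {E B : C} {p : E ⟶ B} {X : C} {d : X ⟶ E} (D : DescentAction p d)
    {T : C} {x x' : T ⟶ X} {e e' : T ⟶ E} (hx : x = x') (he : e = e')
    (h : x ≫ d ≫ p = e ≫ p) : D.act x e h = D.act x' e' (by rw [← hx, ← he, h]) := by
  subst hx he; rfl

/-- Every pullback of `p` is the coequalizer of its kernel pair, over the base. -/
def DescendsMorphisms {E B : C} (p : E ⟶ B) : Prop :=
  ∀ ⦃X A A' : C⦄ (q : X ⟶ A) (d : X ⟶ E) (a : A ⟶ B), IsPullback q d a p →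
    ∀ (a' : A' ⟶ B) (g : X ⟶ A'), g ≫ a' = q ≫ a →
      (∀ ⦃T : C⦄ (x y : T ⟶ X), x ≫ q = y ≫ q → x ≫ g = y ≫ g) →
      ∃! h : A ⟶ A', q ≫ h = g ∧ h ≫ a' = a

/-- Every descent datum relative to `p` comes from a pullback along `p`. -/
def DescendsObjects {E B : C} (p : E ⟶ B) : Prop :=
  ∀ ⦃X : C⦄ (d : X ⟶ E) (D : DescentAction p d),
    ∃ (A : C) (q : X ⟶ A) (a : A ⟶ B), IsPullback q d a p ∧
      ∀ ⦃T : C⦄ (x : T ⟶ X) (e : T ⟶ E) (h : x ≫ d ≫ p = e ≫ p), D.act x e h ≫ q = x ≫ q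

variable [HasPullbacks C] {E B : C} {p : E ⟶ B}

lemma isPullback_baseChange (p : E ⟶ B) (A : Over B) :
    IsPullback (baseChangeFst p A) ((baseChange p).obj A).hom A.hom p :=
  IsPullback.of_hasPullback A.hom p

namespace DescentAction

/-- The transport of elements along a descent datum for the basic fibration. -/
def transport (D : (basicFibration C).DescentData (fun _ : PUnit.{1} ↦ p)) {T : C}
    (x : T ⟶ (D.obj ⟨⟩ : Over E).left) (e : T ⟶ E)
    (h : x ≫ (D.obj ⟨⟩ : Over E).hom ≫ p = e ≫ p) : T ⟶ (D.obj ⟨⟩ : Over E).left :=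
  -- The datum is read at the stage `T` itself, with legs the fibre of `x` and `e`, so the point of
  -- the pullback is `(x, 𝟙 T)`.
  elt (f₁ := x ≫ (D.obj ⟨⟩ : Over E).hom) (f₂ := e) (M₁ := D.obj ⟨⟩)
    (M₂ := D.obj ⟨⟩) (D.hom (e ≫ p) (i₁ := ⟨⟩) (i₂ := ⟨⟩) (x ≫ (D.obj ⟨⟩ : Over E).hom) e
      (by simpa using h) rfl) x (𝟙 T) (by simp)

/-- Compatibility of the datum with pulling back along `y` reduces its component over an arbitrary
`Y`, at the element `(x, y)`, to its component over `T`. Thus a datum is completely determined by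
`transport`. -/
lemma elt_descentData_hom (D : (basicFibration C).DescentData (fun _ : PUnit.{1} ↦ p)) {Y : C}
    (q : Y ⟶ B) (f₁ f₂ : Y ⟶ E) (h₁ : f₁ ≫ p = q) (h₂ : f₂ ≫ p = q) {T : C}
    (x : T ⟶ (D.obj ⟨⟩ : Over E).left) (y : T ⟶ Y) (h : x ≫ (D.obj ⟨⟩ : Over E).hom = y ≫ f₁)
    (e : T ⟶ E) (he : y ≫ f₂ = e) :
    elt (f₁ := f₁) (f₂ := f₂) (M₁ := D.obj ⟨⟩) (M₂ := D.obj ⟨⟩)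
      (D.hom q (i₁ := ⟨⟩) (i₂ := ⟨⟩) f₁ f₂ h₁ h₂) x y h =
      transport D x e (by rw [reassoc_of% h, h₁, ← he, Category.assoc, h₂]) := by
  subst he
  have := D.pullHom_hom y q ((y ≫ f₂) ≫ p) (by rw [Category.assoc, h₂]) (i₁ := ⟨⟩) (i₂ := ⟨⟩)
    f₁ f₂ h₁ h₂ (x ≫ (D.obj ⟨⟩ : Over E).hom) (y ≫ f₂) h.symm rfl
  rw [transport, ← this]
  refine Eq.trans ?_ (elt_pullHom (M₁ := D.obj ⟨⟩) (M₂ := D.obj ⟨⟩) _ y _ _ h.symm rfl x (𝟙 T)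
    (by simp)).symm
  exact elt_congr _ rfl (by simp) _

/-- The action underlying a descent datum for the basic fibration. -/
def ofDescentData (D : (basicFibration C).DescentData (fun _ : PUnit.{1} ↦ p)) :
    DescentAction p (Comma.hom (D.obj ⟨⟩ : Over E)) where
  act _ x e h := transport D x e h
  comp_act T' T t x e h := (comp_elt _ _ _ _ _).trans
    (elt_descentData_hom D _ _ _ _ _ _ _ _ _ (by simp))
  act_comp T x e h := (elt_hom _ _ _ _).trans (by simp)
  act_self T x := by
    have := D.hom_self ((x ≫ (D.obj ⟨⟩ : Over E).hom) ≫ p) (i := ⟨⟩)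
      (x ≫ (D.obj ⟨⟩ : Over E).hom) rfl
    rw [transport, this]
    exact elt_id _ _ _
  act_act T x e e' h h' := by
    -- The cocycle condition, taken at the three legs through which `x` travels: its own fibre, then
    -- `e`, then `e'`.
    have := D.hom_comp (e' ≫ p) (i₁ := ⟨⟩) (i₂ := ⟨⟩) (i₃ := ⟨⟩) (x ≫ (D.obj ⟨⟩ : Over E).hom) e e'
      (by simpa using h.trans h') h' rfl
    refine ((elt_descentData_hom D (e' ≫ p) (x ≫ (D.obj ⟨⟩ : Over E).hom) e'
      (by simpa using h.trans h') rfl x (𝟙 T) (by simp) e' (by simp)).symm.trans ?_).symm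
    rw [← this]
    exact (elt_comp _ _ _ _ _).trans ((elt_congr _
      (elt_descentData_hom D _ _ _ _ _ _ _ _ e (by simp)) rfl _).trans
        (elt_descentData_hom D _ _ _ _ _ _ _ _ e' (by simp)))

lemma homMk_condition {X : C} {d : X ⟶ E} {Y : C} {q : Y ⟶ B} {f₁ f₂ : Y ⟶ E}
    (h₁ : f₁ ≫ p = q) (h₂ : f₂ ≫ p = q) :
    baseChangeFst f₁ (Over.mk d) ≫ d ≫ p = (((baseChange f₁).obj (Over.mk d)).hom ≫ f₂) ≫ p := by
  have := baseChangeFst_condition_assoc f₁ (Over.mk d) p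
  rw [Category.assoc, h₂, ← h₁]
  exact this

/-- The morphism of pulled back objects given by an action. -/
def hom {X : C} {d : X ⟶ E} (D : DescentAction p d) {Y : C} (q : Y ⟶ B) (f₁ f₂ : Y ⟶ E)
    (h₁ : f₁ ≫ p = q) (h₂ : f₂ ≫ p = q) :
    (baseChange f₁).obj (Over.mk d) ⟶ (baseChange f₂).obj (Over.mk d) :=
  Over.homMk (baseChangeLift f₂ (Over.mk d)
    (D.act (baseChangeFst f₁ (Over.mk d)) (((baseChange f₁).obj (Over.mk d)).hom ≫ f₂)
      (homMk_condition h₁ h₂)) _ (D.act_comp _ _ _)) (by simp)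

lemma elt_action_hom {X : C} {d : X ⟶ E} (D : DescentAction p d) {Y : C} (q : Y ⟶ B)
    (f₁ f₂ : Y ⟶ E) (h₁ : f₁ ≫ p = q) (h₂ : f₂ ≫ p = q) {T : C}
    (x : T ⟶ (Over.mk d).left) (y : T ⟶ Y) (h : x ≫ (Over.mk d).hom = y ≫ f₁)
    (e : T ⟶ E) (he : y ≫ f₂ = e) :
    elt (D.hom q f₁ f₂ h₁ h₂) x y h =
      D.act x e (by have := h =≫ p; simpa [← he, h₁, h₂] using this) := by
  subst he
  refine (elt_homMk _ _ _ _ _).trans ((D.comp_act _ _ _ _).trans (D.act_congr ?_ ?_ _)) <;> simp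

/-- The descent datum for the basic fibration given by an action. -/
def toDescentData {X : C} {d : X ⟶ E} (D : DescentAction p d) :
    (basicFibration C).DescentData (fun _ : PUnit.{1} ↦ p) where
  obj _ := Over.mk d
  hom Y q _ _ f₁ f₂ h₁ h₂ := D.hom q f₁ f₂ h₁ h₂
  pullHom_hom Y' Y g q q' hq _ _ f₁ f₂ h₁ h₂ gf₁ gf₂ h₁' h₂' :=
    elt_ext (f₁ := gf₁) (f₂ := gf₂) (M₁ := Over.mk d) (M₂ := Over.mk d) fun T x y h ↦
      (elt_pullHom (M₁ := Over.mk d) (M₂ := Over.mk d) _ _ _ _ h₁' h₂' _ _ _).trans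
        ((elt_action_hom _ _ _ _ _ _ _ _ _ (y ≫ gf₂) (by simp [← h₂'])).trans
          (elt_action_hom _ _ _ _ _ _ _ _ _ _ rfl).symm)
  hom_self Y q _ g hg :=
    elt_ext (f₁ := g) (f₂ := g) (M₁ := Over.mk d) (M₂ := Over.mk d) fun T x y h ↦
      (elt_action_hom _ _ _ _ _ _ _ _ _ _ h.symm).trans
        ((D.act_self _).trans (elt_id _ _ _).symm)
  hom_comp Y q _ _ _ f₁ f₂ f₃ h₁ h₂ h₃ :=
    elt_ext (f₁ := f₁) (f₂ := f₃) (M₁ := Over.mk d) (M₂ := Over.mk d) fun T x y h ↦ by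
      refine (elt_comp (D.hom q f₁ f₂ h₁ h₂) (D.hom q f₂ f₃ h₂ h₃) _ _ _).trans ?_
      rw [elt_action_hom D q f₁ f₃ h₁ h₃ x y h _ rfl,
        elt_action_hom D q f₂ f₃ h₂ h₃ _ y _ _ rfl]
      refine (D.act_congr (elt_action_hom D q f₁ f₂ h₁ h₂ x y h _ rfl) rfl _).trans
        (D.act_act _ _ _ _ (by simp [h₂, h₃]))

end DescentAction
end Descent

/-! ### Effective descent in elementary terms -/

section Descent
variable {C : Type u} [Category.{v} C] [HasPullbacks C] {E B : C} {p : E ⟶ B}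

/-- Up to the isomorphism `ε` between `p^* A` and `X`, the map `g` is a morphism `p^* A ⟶ p^* A'`
over `E`, and the condition on `g` is exactly compatibility with the canonical descent data.
Fullness of the comparison functor gives the descended map and faithfulness its uniqueness. -/
lemma descendsMorphisms_of_isEffectiveDescent (hp : IsEffectiveDescent p) :
    DescendsMorphisms p := by
  intro X A A' q d a sq a' g hg H
  have : ((basicFibration C).toDescentData (fun _ : PUnit.{1} ↦ p)).IsEquivalence := hp
  let ε : ((baseChange p).obj (Over.mk a)).left ⟶ X :=
    sq.lift (baseChangeFst p (Over.mk a)) ((baseChange p).obj (Over.mk a)).hom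
      (baseChangeFst_condition p (Over.mk a))
  have ε_q : ε ≫ q = baseChangeFst p (Over.mk a) := sq.lift_fst _ _ _
  let δ : X ⟶ ((baseChange p).obj (Over.mk a)).left := baseChangeLift p (Over.mk a) q d sq.w
  have δ_fst : δ ≫ baseChangeFst p (Over.mk a) = q := baseChangeLift_fst _ _ _ _ _
  have δε : δ ≫ ε = 𝟙 X := sq.hom_ext (by simp [ε_q, δ_fst]) (by simp [ε, δ])
  let φ : (baseChange p).obj (Over.mk a) ⟶ (baseChange p).obj (Over.mk a') :=
    Over.homMk (baseChangeLift p (Over.mk a') (ε ≫ g) ((baseChange p).obj (Over.mk a)).hom (by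
      have := baseChangeFst_condition p (Over.mk a)
      simp only [Over.mk_hom] at this
      simp [hg, reassoc_of% ε_q, this])) (by simp)
  have φ_fst : φ.left ≫ baseChangeFst p (Over.mk a') = ε ≫ g := by simp [φ]
  let Φ : ((basicFibration C).toDescentData (fun _ : PUnit.{1} ↦ p)).obj (Over.mk a) ⟶
      ((basicFibration C).toDescentData (fun _ : PUnit.{1} ↦ p)).obj (Over.mk a') :=
    { hom _ := φ
      comm Y r _ _ f₁ f₂ h₁ h₂ := by
        refine elt_ext (f₁ := f₁) (f₂ := f₂) (M₁ := (baseChange p).obj (Over.mk a))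
          (M₂ := (baseChange p).obj (Over.mk a')) fun T x y h ↦ ?_
        refine baseChange_hom_ext p _ ?_ ((elt_hom _ _ _ _).trans (elt_hom _ _ _ _).symm)
        have e₁ := elt_ofObj p (Over.mk a) r f₁ f₂ h₁ h₂ x y h
        have e₂ := elt_ofObj p (Over.mk a') r f₁ f₂ h₁ h₂ (x ≫ φ.left) y (by simpa using h)
        -- Transport leaves the component in `A` unchanged, so `x` and its transport have the same
        -- image under `q` and therefore under `g`.
        have e₃ := H _ _ ((Category.assoc _ _ _).trans ((congrArg _ ε_q).trans
          (e₁.trans ((Category.assoc x ε q).trans (congrArg _ ε_q)).symm)))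
        refine (congrArg (· ≫ baseChangeFst p (Over.mk a')) (elt_map_comp _ _ _ _ _)).trans
          (e₂.trans ?_)
        refine Eq.trans ?_ (congrArg (· ≫ baseChangeFst p (Over.mk a'))
          (elt_comp_map _ _ _ _ _)).symm
        simp only [Category.assoc] at e₃
        exact (((Category.assoc _ _ _).trans ((congrArg _ φ_fst).trans e₃)).trans
          ((Category.assoc _ _ _).trans (congrArg _ φ_fst)).symm).symm }
  obtain ⟨h, hh⟩ := ((basicFibration C).toDescentData (fun _ : PUnit.{1} ↦ p)).map_surjective Φ
  replace hh : (baseChange p).map h = φ := congrArg (fun k ↦ k.hom ⟨⟩) hh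
  refine ⟨h.left, ⟨?_, Over.w h⟩, ?_⟩
  · have := congrArg (fun k ↦ δ ≫ k.left ≫ baseChangeFst p (Over.mk a')) hh
    rw [φ_fst, reassoc_of% δε] at this
    refine Eq.trans ?_ this
    refine Eq.trans ?_ (congrArg (δ ≫ ·) (baseChange_map_left_fst p h)).symm
    rw [reassoc_of% δ_fst]
  · rintro k ⟨hk, hk'⟩
    have : (Over.homMk k hk' : Over.mk a ⟶ Over.mk a') = h := by
      apply ((basicFibration C).toDescentData (fun _ : PUnit.{1} ↦ p)).map_injective
      refine Pseudofunctor.DescentData.hom_ext fun _ ↦ ?_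
      refine Eq.trans (b := φ) (Over.OverMorphism.ext (baseChange_hom_ext p _ ?_
        ((Over.w _).trans (Over.w _).symm))) hh.symm
      refine (baseChange_map_left_fst p _).trans (Eq.trans ?_ φ_fst.symm)
      exact (congrArg (· ≫ k) ε_q.symm).trans ((Category.assoc _ _ _).trans (congrArg _ hk))
    exact congrArg (fun k ↦ k.left) this

/-- Essential surjectivity of the comparison functor, applied to the datum of the action. The
pullback square of `p^* A` is carried along the resulting isomorphism, and since that isomorphism
respects the data, transport in `X` also leaves the component in `A` fixed. -/
lemma descendsObjects_of_isEffectiveDescent (hp : IsEffectiveDescent p) :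
    DescendsObjects p := by
  intro X d D
  have : ((basicFibration C).toDescentData (fun _ : PUnit.{1} ↦ p)).IsEquivalence := hp
  let A : Over B := ((basicFibration C).toDescentData (fun _ : PUnit.{1} ↦ p)).objPreimage
    D.toDescentData
  let i : ((basicFibration C).toDescentData (fun _ : PUnit.{1} ↦ p)).obj A ≅ D.toDescentData :=
    ((basicFibration C).toDescentData (fun _ : PUnit.{1} ↦ p)).objObjPreimageIso _
  let φ : (baseChange p).obj A ⟶ Over.mk d := i.hom.hom ⟨⟩
  let ψ : Over.mk d ⟶ (baseChange p).obj A := i.inv.hom ⟨⟩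
  have h₁ : φ ≫ ψ = 𝟙 _ := congrArg (fun k ↦ k.hom ⟨⟩) i.hom_inv_id
  have h₂ : ψ ≫ φ = 𝟙 _ := congrArg (fun k ↦ k.hom ⟨⟩) i.inv_hom_id
  refine ⟨A.left, ψ.left ≫ baseChangeFst p A, A.hom, ?_, fun T x e h ↦ ?_⟩
  · refine (isPullback_baseChange p A).of_iso ((Over.forget _).mapIso ⟨φ, ψ, h₁, h₂⟩) (Iso.refl _)
      (Iso.refl _) (Iso.refl _) ?_ ?_ (by simp) (by simp)
    · have := congrArg (fun k ↦ k.left ≫ baseChangeFst p A) h₁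
      simpa using this.symm
    · simpa using (Over.w φ).symm
  · have c := i.inv.comm (e ≫ p) (i₁ := ⟨⟩) (i₂ := ⟨⟩) (x ≫ d) e (by simpa using h) rfl
    have := congrArg (fun k : (baseChange (x ≫ d)).obj (Over.mk d) ⟶
      (baseChange e).obj ((baseChange p).obj A) ↦ elt k x (𝟙 T) (by simp) ≫ baseChangeFst p A) c
    have e₁ := (congrArg (· ≫ baseChangeFst p A) (elt_map_comp _ ψ x (𝟙 T) (by simp))).trans
      (elt_ofObj p A (e ≫ p) (x ≫ d) e (by simpa using h) rfl (x ≫ ψ.left) (𝟙 T) (by simp))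
    have e₂ := (elt_comp_map (D.hom (e ≫ p) (x ≫ d) e (by simpa using h) rfl) ψ x (𝟙 T)
      (by simp)).trans (congrArg (· ≫ ψ.left)
        (DescentAction.elt_action_hom D _ _ _ _ _ _ _ _ e (by simp)))
    have e₃ := e₁.symm.trans (this.trans (congrArg (· ≫ baseChangeFst p A) e₂))
    simp only [Category.assoc] at e₃
    exact e₃.symm

/-- Faithfulness is the uniqueness and fullness the existence in `DescendsMorphisms`, both for the
square defining `p^* A`; essential surjectivity is `DescendsObjects`. -/
lemma isEffectiveDescent_of_descends (h₁ : DescendsMorphisms p) (h₂ : DescendsObjects p) :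
    IsEffectiveDescent p := by
  refine @Functor.IsEquivalence.mk _ _ _ _ _ ?_ ?_ ?_
  · refine ⟨fun {A A' : Over B} (f g : A ⟶ A') hfg ↦ ?_⟩
    replace hfg : (baseChange p).map f = (baseChange p).map g := congrArg (fun k ↦ k.hom ⟨⟩) hfg
    obtain ⟨k, -, hk⟩ := h₁ _ _ _ (isPullback_baseChange p A) A'.hom (baseChangeFst p A ≫ f.left)
      (by simp) fun T x y h ↦ by rw [reassoc_of% h]
    refine Over.OverMorphism.ext ((hk f.left ⟨rfl, Over.w f⟩).trans
      (hk g.left ⟨?_, Over.w g⟩).symm)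
    rw [← baseChange_map_left_fst, ← baseChange_map_left_fst, hfg]
  · refine ⟨fun {A A' : Over B} Φ ↦ ?_⟩
    let φ : (baseChange p).obj A ⟶ (baseChange p).obj A' := Φ.hom ⟨⟩
    obtain ⟨k, ⟨hk, hk'⟩, -⟩ := h₁ _ _ _ (isPullback_baseChange p A) A'.hom
      (φ.left ≫ baseChangeFst p A') (by
        rw [Category.assoc, baseChangeFst_condition, baseChangeFst_condition,
          reassoc_of% (Over.w φ)]) fun T x y h ↦ by
        have w : (x ≫ ((baseChange p).obj A).hom) ≫ p = (y ≫ ((baseChange p).obj A).hom) ≫ p := by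
          rw [Category.assoc, Category.assoc, ← baseChangeFst_condition, reassoc_of% h]
        have c := Φ.comm _ (i₁ := ⟨⟩) (i₂ := ⟨⟩) (x ≫ ((baseChange p).obj A).hom)
          (y ≫ ((baseChange p).obj A).hom) w rfl
        have := congrArg (fun k : (baseChange (x ≫ ((baseChange p).obj A).hom)).obj
          ((baseChange p).obj A) ⟶ (baseChange (y ≫ ((baseChange p).obj A).hom)).obj
          ((baseChange p).obj A') ↦ elt k x (𝟙 T) (by simp) ≫ baseChangeFst p A') c
        have e₁ := (congrArg (· ≫ baseChangeFst p A') (elt_map_comp _ φ x (𝟙 T) (by simp))).trans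
          (elt_ofObj p A' _ _ _ w rfl (x ≫ φ.left) (𝟙 T) (by simp))
        -- Two elements of `p^* A` with the same component in `A` are related by transport: moving
        -- `x` to the fibre of `y` gives `y`. So a morphism commuting with transport sends them to
        -- elements with the same component in `A'`.
        have e₂ : elt (f₁ := x ≫ ((baseChange p).obj A).hom)
            (f₂ := y ≫ ((baseChange p).obj A).hom) (M₁ := (baseChange p).obj A)
            (M₂ := (baseChange p).obj A) ((Pseudofunctor.DescentData.ofObj
            (F := basicFibration C) (f := fun _ : PUnit.{1} ↦ p) A).hom _ (i₁ := ⟨⟩) (i₂ := ⟨⟩)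
              (x ≫ ((baseChange p).obj A).hom) (y ≫ ((baseChange p).obj A).hom) w rfl) x (𝟙 T)
                (by simp) = y :=
          baseChange_hom_ext _ _ ((elt_ofObj p A _ _ _ w rfl x (𝟙 T) (by simp)).trans h)
            ((elt_hom _ _ _ _).trans (by simp))
        have e₃ := (elt_comp_map _ φ x (𝟙 T) (by simp)).trans (congrArg (· ≫ φ.left) e₂)
        have e₄ := e₁.symm.trans (this.trans (congrArg (· ≫ baseChangeFst p A') e₃))
        simp only [Category.assoc] at e₄
        exact e₄
    refine ⟨Over.homMk k hk', Pseudofunctor.DescentData.hom_ext fun _ ↦ ?_⟩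
    refine Eq.trans (b := φ) (Over.OverMorphism.ext (baseChange_hom_ext p _ ?_
        ((Over.w _).trans (Over.w _).symm))) rfl
    exact (baseChange_map_left_fst p _).trans hk
  · refine ⟨fun D ↦ ?_⟩
    obtain ⟨A, q, a, sq, H⟩ := h₂ _ (DescentAction.ofDescentData D)
    let i : (baseChange p).obj (Over.mk a) ≅ (D.obj ⟨⟩ : Over E) :=
      Over.isoMk ((isPullback_baseChange p (Over.mk a)).isoIsPullback _ _ sq)
        (IsPullback.isoIsPullback_hom_snd _ _ _ _)
    have i_q : i.hom.left ≫ q = baseChangeFst p (Over.mk a) :=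
      IsPullback.isoIsPullback_hom_fst _ _ (isPullback_baseChange p (Over.mk a)) sq
    refine ⟨Over.mk a, ⟨Pseudofunctor.DescentData.isoMk (fun _ ↦ i) fun Y r _ _ f₁ f₂ h₁ h₂ ↦ ?_⟩⟩
    refine elt_ext (f₁ := f₁) (f₂ := f₂) (M₁ := (baseChange p).obj (Over.mk a))
      (M₂ := (D.obj ⟨⟩ : Over E)) fun T x y h ↦ ?_
    refine sq.hom_ext ?_ ((elt_hom _ _ _ _).trans (elt_hom _ _ _ _).symm)
    have hx : (x ≫ i.hom.left) ≫ (D.obj ⟨⟩ : Over E).hom = y ≫ f₁ :=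
      (Category.assoc _ _ _).trans ((congrArg _ (Over.w i.hom)).trans h)
    have e₁ := (elt_map_comp _ i.hom x y h).trans
      (DescentAction.elt_descentData_hom D r f₁ f₂ h₁ h₂ (x ≫ i.hom.left) y hx _ rfl)
    refine (congrArg (· ≫ q) e₁).trans
      ((H _ _ ((Category.assoc _ _ _).symm.trans
        ((congrArg (· ≫ p) hx).trans (by simp [h₁, h₂])))).trans ?_)
    refine Eq.trans ?_ (congrArg (· ≫ q) (elt_comp_map _ i.hom x y h)).symm
    rw [Category.assoc, Category.assoc, i_q]
    exact (elt_ofObj p (Over.mk a) r f₁ f₂ h₁ h₂ x y h).symm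

end Descent

/-! ### Descent along a fully faithful functor preserving pullbacks -/

section Transfer
universe v₁ v₂ u₁ u₂
variable {C : Type u₁} [Category.{v₁} C] [HasPullbacks C] {D : Type u₂} [Category.{v₂} D]
  (U : C ⥤ D) [PreservesLimitsOfShape WalkingCospan U] {E B : C} {p : E ⟶ B}

lemma DescendsMorphisms.of_map [U.Full] [U.Faithful] (hp : DescendsMorphisms (U.map p)) : DescendsMorphisms p := by
  intro X A A' q d a sq a' g hg H
  obtain ⟨h, ⟨h₁, h₂⟩, h₃⟩ := hp _ _ _ (sq.map U) (U.map a') (U.map g)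
    (by rw [← U.map_comp, hg, U.map_comp]) fun T x y hxy ↦ by
      -- A pair of elements of `U.obj X` identified by `U.map q` factors through the image of the
      -- kernel pair of `q`, so it is enough to know `H` for the two projections of that kernel
      -- pair.
      have sq' := (IsPullback.of_hasPullback q q).map U
      rw [← sq'.lift_fst x y hxy]
      conv_rhs => rw [← sq'.lift_snd x y hxy]
      rw [Category.assoc, Category.assoc, ← U.map_comp, ← U.map_comp, H _ _ pullback.condition]
  refine ⟨U.preimage h, ⟨U.map_injective (by simpa using h₁), U.map_injective (by simpa using h₂)⟩,
    fun k ⟨hk, hk'⟩ ↦ U.map_injective ?_⟩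
  rw [U.map_preimage]
  exact h₃ _ ⟨by rw [← U.map_comp, hk], by rw [← U.map_comp, hk']⟩

namespace DescentAction
variable {X : C} {d : X ⟶ E} (α : DescentAction p d)

lemma isPullback_map_pullback {X : C} (d : X ⟶ E) (p : E ⟶ B) :
    IsPullback (U.map (pullback.fst (d ≫ p) p)) (U.map (pullback.snd (d ≫ p) p))
      (U.map d ≫ U.map p) (U.map p) := by
  simpa using (IsPullback.of_hasPullback (d ≫ p) p).map U

/-- The transport in the image of a functor preserving pullbacks. -/
def mapAct {T : D} (x : T ⟶ U.obj X) (e : T ⟶ U.obj E)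
    (h : x ≫ U.map d ≫ U.map p = e ≫ U.map p) : T ⟶ U.obj X :=
  (isPullback_map_pullback U d p).lift x e h ≫
    U.map (α.act (pullback.fst (d ≫ p) p) (pullback.snd (d ≫ p) p) pullback.condition)

/-- By naturality the action in the image may be computed at any stage `T'` of the source category
through which both elements factor, and not only at the generic stage `X ×_B E`. Each axiom for the
transported action is checked at a suitable such stage. -/
lemma mapAct_eq {T : D} {T' : C} (m : T ⟶ U.obj T') (a : T' ⟶ X) (b : T' ⟶ E)
    (h : a ≫ d ≫ p = b ≫ p) {x : T ⟶ U.obj X} {e : T ⟶ U.obj E} (hx : x = m ≫ U.map a)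
    (he : e = m ≫ U.map b) (h' : x ≫ U.map d ≫ U.map p = e ≫ U.map p) :
    α.mapAct U x e h' = m ≫ U.map (α.act a b h) := by
  subst hx he
  have : (isPullback_map_pullback U d p).lift (m ≫ U.map a) (m ≫ U.map b) h' =
      m ≫ U.map (pullback.lift a b h) :=
    (isPullback_map_pullback U d p).hom_ext
      (by rw [IsPullback.lift_fst, Category.assoc, ← U.map_comp, pullback.lift_fst])
      (by rw [IsPullback.lift_snd, Category.assoc, ← U.map_comp, pullback.lift_snd])
  rw [mapAct, this, Category.assoc, ← U.map_comp, α.comp_act]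
  simp only [pullback.lift_fst, pullback.lift_snd]

/-- The image of a descent datum under a functor preserving pullbacks. -/
def map : DescentAction (U.map p) (U.map d) where
  act T x e h := α.mapAct U x e h
  comp_act T' T t x e h := by
    rw [mapAct, mapAct, ← Category.assoc]
    congr 1
    exact (isPullback_map_pullback U d p).hom_ext (by simp) (by simp)
  act_comp T x e h := by
    rw [mapAct, Category.assoc, ← U.map_comp (α.act _ _ _), α.act_comp, IsPullback.lift_snd]
  act_self T x := by
    rw [α.mapAct_eq U x (𝟙 X) d (by simp) (by simp) rfl]
    have := α.act_self (𝟙 X)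
    simp only [Category.id_comp] at this
    rw [this, U.map_id, Category.comp_id]
  act_act T x e e' h h' := by
    -- The generic stage for two successive transports is `(X ×_B E) ×_B E`; the triple `(x, e, e')`
    -- factors through its image by `m`.
    have sq := (IsPullback.of_hasPullback (pullback.snd (d ≫ p) p ≫ p) p).map U
    let m := sq.lift ((isPullback_map_pullback U d p).lift x e h) e' (by
      rw [U.map_comp, IsPullback.lift_snd_assoc, h'])
    have h₁ : m ≫ U.map (pullback.fst _ _) = (isPullback_map_pullback U d p).lift x e h :=
      sq.lift_fst _ _ _
    have h₂ : m ≫ U.map (pullback.snd _ _) = e' := sq.lift_snd _ _ _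
    have w := pullback.condition (f := pullback.snd (d ≫ p) p ≫ p) (g := p)
    have hx : x = m ≫ U.map (pullback.fst _ _ ≫ pullback.fst (d ≫ p) p) := by
      rw [U.map_comp, reassoc_of% h₁, IsPullback.lift_fst]
    have w' : (pullback.fst (pullback.snd (d ≫ p) p ≫ p) p ≫ pullback.fst (d ≫ p) p) ≫ d ≫ p =
        (pullback.fst (pullback.snd (d ≫ p) p ≫ p) p ≫ pullback.snd (d ≫ p) p) ≫ p := by
      rw [Category.assoc, pullback.condition, Category.assoc]
    rw [α.mapAct_eq U m (α.act _ _ w') (pullback.snd _ _) _ _ h₂.symm,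
      α.mapAct_eq U m _ (pullback.snd _ _) (w'.trans ((Category.assoc _ _ _).trans w)) hx h₂.symm,
      α.act_act _ _ _ w' ((Category.assoc _ _ _).trans w)]
    · rw [reassoc_of% (α.act_comp _ _ w'), w]
    · rw [mapAct, ← h₁, Category.assoc, ← U.map_comp, α.comp_act]

end DescentAction

/-- The action is moved to `D`, where it descends to an object `A`. The assumption `hU` brings `A`
back to `C`, and full faithfulness brings back the maps, the pullback property and the equation on
elements. -/
lemma DescendsObjects.of_map [U.Full] [U.Faithful] (hp : DescendsObjects (U.map p))
    (hU : ∀ ⦃X : C⦄ ⦃A : D⦄ (q : U.obj X ⟶ A) (d : X ⟶ E) (a : A ⟶ U.obj B),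
      IsPullback q (U.map d) a (U.map p) → U.essImage A) : DescendsObjects p := by
  intro X d α
  obtain ⟨A, q, a, sq, H⟩ := hp _ (α.map U)
  obtain ⟨A', ⟨i⟩⟩ := hU q d a sq
  refine ⟨A', U.preimage (q ≫ i.inv), U.preimage (i.hom ≫ a), ?_, fun T x e h ↦ ?_⟩
  · refine IsPullback.of_map U (U.map_injective ?_) ?_
    · simpa using sq.w
    · exact sq.of_iso (Iso.refl _) i.symm (Iso.refl _) (Iso.refl _) (by simp) (by simp) (by simp)
        (by simp)
  · have h' : U.map x ≫ U.map d ≫ U.map p = U.map e ≫ U.map p := by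
      simp only [← U.map_comp, h]
    refine U.map_injective ?_
    have := H (U.map x) (U.map e) h'
    have e₁ : (α.map U).act (U.map x) (U.map e) h' = U.map (α.act x e h) :=
      (α.mapAct_eq U (𝟙 _) x e h (by simp) (by simp) h').trans (Category.id_comp _)
    rw [e₁] at this
    simp [reassoc_of% this]

end Transfer

/-! ### Pullbacks of coproducts in a lextensive category -/

section Coproducts
variable {V : Type u} [Category.{v} V]

/-- Summands which are initial may be dropped from a coproduct. -/
lemma nonempty_isColimit_of_isInitial {L M : Type*} {e : L → M} (he : Function.Injective e)
    {A : M → V} {c : Cofan A} (hc : IsColimit c)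
    (h : ∀ m, (¬ ∃ l, e l = m) → Nonempty (IsInitial (A m))) {B : L → V}
    (i : ∀ l, B l ≅ A (e l)) :
    Nonempty (IsColimit (Cofan.mk c.pt fun l ↦ (i l).hom ≫ c.inj (e l))) := by
  classical
  -- The component at `m` is forced if `m = e l`, where injectivity makes `l` unique, and otherwise
  -- is the map out of an initial object. The cast lets one statement cover both cases.
  have H (t : Cofan B) (m : M) : ∃ f : A m ⟶ t.pt, ∀ (l : L) (hl : e l = m),
      (i l).hom ≫ eqToHom (by rw [hl]) ≫ f = t.inj l := by
    by_cases hm : ∃ l, e l = m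
    · obtain ⟨l, rfl⟩ := hm
      refine ⟨(i l).inv ≫ t.inj l, fun l' hl ↦ ?_⟩
      obtain rfl := he hl
      simp
    · exact ⟨(h m hm).some.to _, fun l hl ↦ (hm ⟨l, hl⟩).elim⟩
  choose F hF using H
  refine ⟨Cofan.IsColimit.mk _ (fun t ↦ Cofan.IsColimit.desc hc (F t)) (fun t l ↦ ?_)
    fun t k hk ↦ Cofan.IsColimit.hom_ext hc _ _ fun m ↦ ?_⟩
  · have := hF t _ l rfl
    simpa using this
  · rw [Cofan.IsColimit.fac]
    by_cases hm : ∃ l, e l = m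
    · obtain ⟨l, rfl⟩ := hm
      have := (hk l).trans (hF t _ l rfl).symm
      simpa using this
    · exact (h m hm).some.hom_ext _ _

variable [InfinitaryLextensive V]

instance : HasInitial V :=
  have : HasCoproducts.{0} V := has_smallest_coproducts_of_hasCoproducts
  inferInstance

lemma mono_inj {ι : Type v} {A : ι → V} {c : Cofan A} (hc : IsColimit c) (i : ι) :
    Mono (c.inj i) :=
  mono_of_cofan_isVanKampen (InfinitaryLextensive.isVanKampenColimit c hc) ⟨i⟩

/-- The initial object is strict. -/
lemma nonempty_isInitial_of_hom {Q : V} (f : Q ⟶ ⊥_ V) : Nonempty (IsInitial Q) := by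
  -- The initial object is the empty coproduct, and the empty family of squares over it is vacuously
  -- one of pullbacks; stability makes `Q` an empty coproduct too.
  let d : Cofan (fun i : PEmpty.{v + 1} ↦ (i.elim : V)) := Cofan.mk (⊥_ V) fun i ↦ i.elim
  have hd : IsColimit d := Cofan.IsColimit.mk _ (fun t ↦ initial.to _) (fun _ i ↦ i.elim)
    (fun _ _ _ ↦ initialIsInitial.hom_ext _ _)
  let c : Cofan (fun i : PEmpty.{v + 1} ↦ (i.elim : V)) := Cofan.mk Q fun i ↦ i.elim
  obtain ⟨hc⟩ := nonempty_isColimit_of_isPullback hd (fun _ ↦ 𝟙 _) c f fun i ↦ i.elim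
  exact ⟨IsInitial.ofUniqueHom (fun Y ↦ Cofan.IsColimit.desc (c := c) hc fun i ↦ i.elim)
    fun Y m ↦ Cofan.IsColimit.hom_ext hc _ _ fun i ↦ i.elim⟩

/-- Coproducts are disjoint. -/
lemma nonempty_isInitial_of_ne {ι : Type v} {A : ι → V} {c : Cofan A} (hc : IsColimit c)
    {i j : ι} (hij : i ≠ j) {Q : V} (f : Q ⟶ A i) (g : Q ⟶ A j) (h : f ≫ c.inj i = g ≫ c.inj j) :
    Nonempty (IsInitial Q) :=
  nonempty_isInitial_of_hom ((isPullback_initial_to_of_cofan_isVanKampen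
    (InfinitaryLextensive.isVanKampenColimit c hc) ⟨i⟩ ⟨j⟩ (by simpa using hij)).lift f g h)

/-- A coproduct of pullbacks indexed by a fibre product of sets is a pullback of coproducts. -/
lemma isPullback_of_isColimit {I J K L : Type v} {A : I → V} {B : J → V} {C : K → V} {P : L → V}
    {a : Cofan A} (ha : IsColimit a) {b : Cofan B} (hb : IsColimit b) {c : Cofan C}
    (hc : IsColimit c) {d : Cofan P} (hd : IsColimit d) {α : I → K} {β : J → K}
    {f : a.pt ⟶ c.pt} {φ : ∀ i, A i ⟶ C (α i)} (hf : ∀ i, a.inj i ≫ f = φ i ≫ c.inj (α i))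
    {g : b.pt ⟶ c.pt} {γ : ∀ j, B j ⟶ C (β j)} (hg : ∀ j, b.inj j ≫ g = γ j ≫ c.inj (β j))
    {π : L → I × J} (hπ : Function.Injective π) (hπ' : ∀ i j, α i = β j → ∃ l, π l = (i, j))
    {r : ∀ l, P l ⟶ A (π l).1} {s : ∀ l, P l ⟶ B (π l).2}
    (hP : ∀ l, IsPullback (r l) (s l) (a.inj _ ≫ f) (b.inj _ ≫ g))
    {u : d.pt ⟶ a.pt} (hu : ∀ l, d.inj l ≫ u = r l ≫ a.inj _)
    {w : d.pt ⟶ b.pt} (hw : ∀ l, d.inj l ≫ w = s l ≫ b.inj _) : IsPullback u w f g := by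
  -- Universality in both variables decomposes the pullback over all pairs of indices, including
  -- those with different images in `K`.
  let D : Cofan fun m : I × J ↦ pullback (a.inj m.1 ≫ f) (b.inj m.2 ≫ g) :=
    Cofan.mk (pullback f g) fun m ↦ pullback.lift (pullback.fst _ _ ≫ a.inj m.1)
      (pullback.snd _ _ ≫ b.inj m.2) (by simp [pullback.condition])
  obtain ⟨hD⟩ : Nonempty (IsColimit D) :=
    IsUniversalColimit.nonempty_isColimit_prod_of_isPullback
      (InfinitaryLextensive.isVanKampenColimit a ha).isUniversal
      (InfinitaryLextensive.isVanKampenColimit b hb).isUniversal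
      (fun i ↦ a.inj i ≫ f) (fun j ↦ b.inj j ≫ g) f g
      (fun i j ↦ IsPullback.of_hasPullback (a.inj i ≫ f) (b.inj j ≫ g))
      (IsPullback.of_hasPullback f g) (d := D) (Iso.refl _) (fun _ ↦ rfl) (fun _ ↦ rfl)
      (fun i j ↦ by simp [D, pullback.lift_fst]) (fun i j ↦ by simp [D, pullback.lift_snd])
  -- Over a pair with `α i ≠ β j` the summand maps to two distinct summands of a disjoint coproduct
  -- and hence is initial; dropping these pairs leaves exactly the indices in `L`.
  obtain ⟨hL⟩ := nonempty_isColimit_of_isInitial hπ hD (fun ⟨i, j⟩ hm ↦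
    nonempty_isInitial_of_ne hc (fun h ↦ hm (hπ' i j h))
      (pullback.fst (a.inj i ≫ f) (b.inj j ≫ g) ≫ φ i) (pullback.snd _ _ ≫ γ j) (by
        simp only [Category.assoc, ← hf, ← hg, pullback.condition])) fun l ↦ (hP l).isoPullback
  have e (l : L) : ((hP l).isoPullback.hom ≫ D.inj (π l)) ≫
      (hL.coconePointUniqueUpToIso hd).hom = d.inj l :=
    hL.comp_coconePointUniqueUpToIso_hom hd ⟨l⟩
  refine (IsPullback.of_hasPullback f g).of_iso (hL.coconePointUniqueUpToIso hd) (Iso.refl _)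
    (Iso.refl _) (Iso.refl _) ?_ ?_ (by simp) (by simp)
  · refine Cofan.IsColimit.hom_ext hL _ _ fun l ↦ ?_
    have := e l =≫ u
    simp only [Category.assoc, hu] at this
    simpa [D, pullback.lift_fst] using this.symm
  · refine Cofan.IsColimit.hom_ext hL _ _ fun l ↦ ?_
    have := e l =≫ w
    simp only [Category.assoc, hw] at this
    simpa [D, pullback.lift_snd] using this.symm

end Coproducts

/-! ### Full faithfulness of the inclusion -/

section Inclusion
variable {V : Type u} [Category.{v} V] [CartesianMonoidalCategory V] [InfinitaryLextensive V]

instance mono_pt {X : Type v} (x : X) : Mono (pt (V := V) x) :=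
  mono_inj (coproductIsCoproduct fun _ : X ↦ 𝟙_ V) x

lemma pt_comp_map {X Y : Type v} (f : X ⟶ Y) (x : X) :
    pt x ≫ (sigmaConst.{v}.obj (𝟙_ V)).map f = pt (f x) :=
  (Sigma.ι_comp_map' (f := fun _ : X ↦ 𝟙_ V) (g := fun _ : Y ↦ 𝟙_ V) f (fun _ ↦ 𝟙 (𝟙_ V)) x).trans
    (Category.id_comp _)

namespace VCat

section
variable {X Y : VCat.{v} V}

instance mono_inc (x y : X) : Mono (inc x y) := mono_inj X.isColimitHoms (x, y)

lemma castHom_inc {x x' y y' : X} (h : x = x') (h' : y = y') :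
    castHom h h' ≫ inc x' y' = inc x y := by
  subst h h'; simp

/-- The hom-objects are the fibres of the source and the target. -/
lemma exists_comp_inc {T : V} (f : T ⟶ X.homs) (x y : X) (h : f ≫ X.src = toUnit T ≫ pt x)
    (h' : f ≫ X.tgt = toUnit T ≫ pt y) : ∃ k : T ⟶ (x ⟶[V] y), k ≫ inc x y = f := by
  -- The fibre is taken in two steps: fixing the source leaves `∐ y, (x ⟶[V] y)`, and fixing the
  -- target then leaves one summand.
  have sq₁ := isPullback_src x
  have sq₂ : IsPullback (Sigma.ι (fun y : X ↦ (x ⟶[V] y)) y) (toUnit _)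
      ((Sigma.desc fun y ↦ inc x y) ≫ X.tgt) (pt y) :=
    isPullback_of_cofan (coproductIsCoproduct fun y : X ↦ (x ⟶[V] y))
      (coproductIsCoproduct fun _ : X ↦ 𝟙_ V) (fun _ ↦ toUnit _)
      ((Sigma.desc fun y ↦ inc x y) ≫ X.tgt) (fun y ↦ by simp [pt]) y
  refine ⟨sq₂.lift (sq₁.lift f _ h) (toUnit T) (by rw [IsPullback.lift_fst_assoc, h']), ?_⟩
  have := sq₂.lift_fst (sq₁.lift f _ h) (toUnit T)
    (by rw [IsPullback.lift_fst_assoc, h']) =≫ Sigma.desc fun y ↦ inc x y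
  rw [Category.assoc, Sigma.ι_desc, IsPullback.lift_fst] at this
  exact this

lemma inc_mul {T : V} {x y z : X} (f : T ⟶ (x ⟶[V] y)) (g : T ⟶ (y ⟶[V] z))
    (h : (f ≫ inc x y) ≫ X.tgt = (g ≫ inc y z) ≫ X.src) :
    X.toInternalCat.mul (f ≫ inc x y) (g ≫ inc y z) h = (lift f g ≫ eComp V x y z) ≫ inc x z :=
  (lift_comp f g).trans (Category.assoc _ _ _).symm

/-- Hom-objects with equal endpoints are compared through a cast, which disappears after composing
with the monomorphism `inc`. -/
lemma hom_ext_of_mapHoms {F G : X ⟶ Y} (h : ∀ x, F.obj x = G.obj x) (h' : mapHoms F = mapHoms G) :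
    F = G := by
  refine EnrichedFunctor.ext V h fun x y ↦ ?_
  rw [← cancel_mono (inc _ _)]
  have := inc x y ≫= h'
  rw [inc_mapHoms, inc_mapHoms] at this
  rw [← this]
  refine (Category.assoc _ _ _).trans (congrArg _ ?_)
  exact castHom_inc (h x) (h y)

end

end VCat

variable (V) in
-- On objects, `ι(F)` is the image under `J` of the function underlying `F`, so faithfulness of `J`
-- recovers that function; the injections of hom-objects are monic, which recovers the rest.
lemma inclusion_faithful (hJ : (sigmaConst.{v}.obj (𝟙_ V) : Type v ⥤ V).Faithful) :
    (inclusion V).Faithful where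
  map_injective {X Y} F G h := by
    have h₁ : VCat.mapObj F = VCat.mapObj G := congrArg InternalFunctor.obj h
    have h₂ (F : X ⟶ Y) : VCat.mapObj F = (sigmaConst.{v}.obj (𝟙_ V)).map (↾F.obj) :=
      VCat.coprodUnit_hom_ext fun x ↦ (VCat.pt_mapObj F x).trans (pt_comp_map (↾F.obj) x).symm
    rw [h₂, h₂] at h₁
    exact VCat.hom_ext_of_mapHoms (fun x ↦ congrArg (fun k ↦ k x) (hJ.map_injective h₁))
      (congrArg InternalFunctor.arr h)

variable (V) in
-- Fullness of `J` turns the map on objects into a function `f`. The arrow part then sends the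
-- summand of `(x, y)` into the fibre over `(f x, f y)`, which is a hom-object. The functor axioms
-- are checked after composing with the monomorphism `inc`.
lemma inclusion_full (hJ : (sigmaConst.{v}.obj (𝟙_ V) : Type v ⥤ V).Full) :
    (inclusion V).Full where
  map_surjective {X Y} Φ := by
    obtain ⟨f, hf⟩ : ∃ f : X → Y, ∀ x, pt x ≫ Φ.obj = pt (f x) := by
      obtain ⟨f, hf⟩ := hJ.map_surjective Φ.obj
      exact ⟨f, fun x ↦ (congrArg _ hf.symm).trans (pt_comp_map f x)⟩
    have H (x y : X) : ∃ k : (x ⟶[V] y) ⟶ (f x ⟶[V] f y), k ≫ VCat.inc (f x) (f y) =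
        VCat.inc x y ≫ Φ.arr := by
      refine VCat.exists_comp_inc _ _ _ ?_ ?_
      · have h := (VCat.inc x y ≫= Φ.arr_src).trans ((Category.assoc _ _ _).symm.trans
          ((VCat.inc_src x y =≫ Φ.obj).trans (Category.assoc _ _ _)))
        exact (Category.assoc _ _ _).trans (h.trans (congrArg _ (hf x)))
      · have h := (VCat.inc x y ≫= Φ.arr_tgt).trans ((Category.assoc _ _ _).symm.trans
          ((VCat.inc_tgt x y =≫ Φ.obj).trans (Category.assoc _ _ _)))
        exact (Category.assoc _ _ _).trans (h.trans (congrArg _ (hf y)))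
    choose k hk using H
    refine ⟨EnrichedFunctor.mk (V := V) f k (fun x ↦ ?_) (fun x y z ↦ ?_), ?_⟩
    · rw [← cancel_mono (VCat.inc _ _), Category.assoc, hk]
      have h₁ := (Category.assoc _ _ _).trans (pt x ≫= Φ.ident_arr)
      have h₂ := (congrArg (· ≫ Φ.arr) (VCat.pt_ident x)).symm.trans h₁
      exact (Category.assoc _ _ _).symm.trans (h₂.trans ((Category.assoc _ _ _).symm.trans
        ((congrArg (· ≫ Y.ident) (hf x)).trans (VCat.pt_ident (f x)))))
    · rw [← cancel_mono (VCat.inc _ _), Category.assoc, hk]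
      have w : (fst (x ⟶[V] y) (y ⟶[V] z) ≫ VCat.inc x y) ≫ X.tgt =
        (snd _ _ ≫ VCat.inc y z) ≫ X.src := by simp
      have w' : ((fst (x ⟶[V] y) (y ⟶[V] z) ≫ k x y) ≫ VCat.inc (f x) (f y)) ≫ Y.tgt =
        ((snd _ _ ≫ k y z) ≫ VCat.inc (f y) (f z)) ≫ Y.src := by simp
      have h₁ := Φ.mul_arr _ _ w
      have h₂ := (congrArg (· ≫ Φ.arr) (VCat.inc_mul _ _ w)).symm.trans (h₁.trans
        ((Y.toInternalCat.mul_congr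
          ((Category.assoc _ _ _).trans ((congrArg _ (hk x y).symm).trans (Category.assoc _ _ _).symm))
          ((Category.assoc _ _ _).trans ((congrArg _ (hk y z).symm).trans (Category.assoc _ _ _).symm))
          ).trans (VCat.inc_mul _ _ w')))
      have e₁ : lift (fst (x ⟶[V] y) (y ⟶[V] z)) (snd _ _) = 𝟙 _ := by ext <;> simp
      have e₂ : lift (fst (x ⟶[V] y) (y ⟶[V] z) ≫ k x y) (snd _ _ ≫ k y z) =
        k x y ⊗ₘ k y z := by ext <;> simp
      rw [e₁, e₂, Category.id_comp] at h₂
      exact (Category.assoc _ _ _).symm.trans h₂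
    · refine InternalCat.hom_ext ?_ ?_
      · refine VCat.coprodUnit_hom_ext fun x ↦ ?_
        exact (VCat.pt_mapObj _ _).trans (hf x).symm
      · refine VCat.homs_hom_ext fun x y ↦ ?_
        exact (VCat.inc_mapHoms _ _ _).trans (hk x y)

end Inclusion

/-! ### Componentwise pullbacks of internal categories -/

namespace InternalCat
variable {V : Type u} [Category.{v} V] [HasPullbacks V] {X Y Z P : InternalCat V}

lemma isIso_of_isIso (Φ : X ⟶ Y) (h₁ : IsIso Φ.obj) (h₂ : IsIso Φ.arr) : IsIso Φ := by
  have hs : inv Φ.arr ≫ X.src = Y.src ≫ inv Φ.obj := by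
    rw [IsIso.inv_comp_eq, ← Category.assoc, IsIso.eq_comp_inv, Φ.arr_src]
  have ht : inv Φ.arr ≫ X.tgt = Y.tgt ≫ inv Φ.obj := by
    rw [IsIso.inv_comp_eq, ← Category.assoc, IsIso.eq_comp_inv, Φ.arr_tgt]
  let Ψ : Y ⟶ X :=
    { obj := inv Φ.obj
      arr := inv Φ.arr
      arr_src := hs
      arr_tgt := ht
      ident_arr := by
        rw [IsIso.comp_inv_eq, Category.assoc, IsIso.eq_inv_comp, Φ.ident_arr]
      comp_arr := by
        have w : (pullback.fst Y.tgt Y.src ≫ inv Φ.arr) ≫ X.tgt =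
            (pullback.snd Y.tgt Y.src ≫ inv Φ.arr) ≫ X.src := by
          rw [Category.assoc, Category.assoc, hs, ht, pullback.condition_assoc]
        have := Φ.mul_arr _ _ w
        simp only [Category.assoc, IsIso.inv_hom_id, Category.comp_id] at this
        rw [IsIso.comp_inv_eq, comp_eq_mul]
        exact this.symm }
  exact ⟨Ψ, InternalCat.hom_ext (by simp [Ψ]) (by simp [Ψ]),
    InternalCat.hom_ext (by simp [Ψ]) (by simp [Ψ])⟩

/-- A square of internal categories is a pullback if it is one on objects and on arrows. -/
lemma isPullback_of_isPullback {f : P ⟶ X} {g : P ⟶ Y} {F : X ⟶ Z} {G : Y ⟶ Z}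
    (h₁ : IsPullback f.obj g.obj F.obj G.obj) (h₂ : IsPullback f.arr g.arr F.arr G.arr) :
    IsPullback f g F G := by
  let Φ : P ⟶ pullbackCat F G := pullbackLift f g (InternalCat.hom_ext h₁.w h₂.w)
  have : IsIso Φ := isIso_of_isIso Φ (inferInstanceAs (IsIso h₁.isoPullback.hom))
    (inferInstanceAs (IsIso h₂.isoPullback.hom))
  exact (isPullback_pullbackCat F G).of_iso (asIso Φ).symm (Iso.refl _) (Iso.refl _) (Iso.refl _)
    (by rw [Iso.refl_hom, Category.comp_id, Iso.symm_hom, Iso.eq_inv_comp]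
        exact InternalCat.hom_ext (pullback.lift_fst _ _ _) (pullback.lift_fst _ _ _))
    (by rw [Iso.refl_hom, Category.comp_id, Iso.symm_hom, Iso.eq_inv_comp]
        exact InternalCat.hom_ext (pullback.lift_snd _ _ _) (pullback.lift_snd _ _ _))
    (by simp) (by simp)

lemma isPullback_obj {f : P ⟶ X} {g : P ⟶ Y} {F : X ⟶ Z} {G : Y ⟶ Z}
    (h : IsPullback f g F G) : IsPullback f.obj g.obj F.obj G.obj := by
  let i := (isPullback_pullbackCat F G).isoIsPullback _ _ h
  let j : (pullbackCat F G).obj ≅ P.obj :=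
    ⟨i.hom.obj, i.inv.obj, congrArg InternalFunctor.obj i.hom_inv_id,
      congrArg InternalFunctor.obj i.inv_hom_id⟩
  refine (IsPullback.of_hasPullback F.obj G.obj).of_iso j (Iso.refl _) (Iso.refl _) (Iso.refl _)
    ?_ ?_ (by simp) (by simp)
  · exact (Category.comp_id _).trans (congrArg InternalFunctor.obj
      (IsPullback.isoIsPullback_hom_fst _ _ (isPullback_pullbackCat F G) h)).symm
  · exact (Category.comp_id _).trans (congrArg InternalFunctor.obj
      (IsPullback.isoIsPullback_hom_snd _ _ (isPullback_pullbackCat F G) h)).symm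

end InternalCat

/-- A monomorphism on the corner imposes the same equations. This turns a pullback over one summand
into a pullback over the whole coproduct. -/
lemma isPullback_comp_mono {V : Type u} [Category.{v} V] {P X Y Z W : V} {a : P ⟶ X} {b : P ⟶ Y}
    {f : X ⟶ Z} {g : Y ⟶ Z} (h : IsPullback a b f g) (m : Z ⟶ W) [Mono m] : IsPullback a b (f ≫ m) (g ≫ m) :=
  ⟨⟨by rw [reassoc_of% h.w]⟩, ⟨PullbackCone.isLimitOfCompMono f g m _ h.isLimit⟩⟩

/-! ### Preservation of pullbacks by the inclusion -/

section Inclusion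
variable {V : Type u} [Category.{v} V] [CartesianMonoidalCategory V] [InfinitaryLextensive V]

/-- Here `π` identifies `L` with the fibre product of the index sets. The statement allows any such
`L`, since it serves both for the objects of a pullback of `V`-categories and for pulling back along
a section. -/
lemma isPullback_coprodUnit {I J K L : Type v} {α : I → K} {β : J → K} {π : L → I × J}
    (hπ : Function.Injective π) (hπ' : ∀ i j, α i = β j ↔ ∃ l, π l = (i, j))
    {f : coprodUnit (V := V) I ⟶ coprodUnit K} (hf : ∀ i, pt i ≫ f = pt (α i))
    {g : coprodUnit (V := V) J ⟶ coprodUnit K} (hg : ∀ j, pt j ≫ g = pt (β j))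
    {u : coprodUnit (V := V) L ⟶ coprodUnit I} (hu : ∀ l, pt l ≫ u = pt (π l).1)
    {w : coprodUnit (V := V) L ⟶ coprodUnit J} (hw : ∀ l, pt l ≫ w = pt (π l).2) :
    IsPullback u w f g := by
  have hc (X : Type v) := coproductIsCoproduct fun _ : X ↦ 𝟙_ V
  refine isPullback_of_isColimit (hc I) (hc J) (hc K) (hc L) (φ := fun _ ↦ 𝟙 _) (γ := fun _ ↦ 𝟙 _)
    (α := α) (β := β) (r := fun _ ↦ 𝟙 _) (s := fun _ ↦ 𝟙 _)
    (fun i ↦ (hf i).trans (Category.id_comp _).symm)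
    (fun i ↦ (hg i).trans (Category.id_comp _).symm) hπ (fun i j ↦ (hπ' i j).1) (fun l ↦ ?_)
    (fun i ↦ (hu i).trans (Category.id_comp _).symm)
    (fun i ↦ (hw i).trans (Category.id_comp _).symm)
  have e := (hπ' _ _).2 ⟨l, rfl⟩
  -- Over a matching pair both legs are the same point of the coproduct, and a point is monic, so
  -- the identities of the unit form the required pullback.
  have := isPullback_comp_mono (IsPullback.id_horiz (𝟙 (𝟙_ V))) (pt (V := V) (α (π l).1))
  rw [Category.id_comp] at this
  convert! this using 1
  · exact hf _
  · rw [e]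
    exact hg _

variable {X Y Z : VCat.{v} V} (F : X ⟶ Z) (G : Y ⟶ Z)

lemma isPullback_mapObj : IsPullback (VCat.mapObj (VCat.pullbackFst F G))
    (VCat.mapObj (VCat.pullbackSnd F G)) (VCat.mapObj F) (VCat.mapObj G) :=
  isPullback_coprodUnit (π := fun p : VCat.PullbackObj F G ↦ p.1) Subtype.val_injective
    (fun i j ↦ ⟨fun h ↦ ⟨⟨(i, j), h⟩, rfl⟩, by rintro ⟨l, hl⟩; have := l.2; rwa [hl] at this⟩)
    (VCat.pt_mapObj _) (VCat.pt_mapObj _) (VCat.pt_mapObj (VCat.pullbackFst F G))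
    (VCat.pt_mapObj (VCat.pullbackSnd F G))

lemma isPullback_mapHoms : IsPullback (VCat.mapHoms (VCat.pullbackFst F G))
    (VCat.mapHoms (VCat.pullbackSnd F G)) (VCat.mapHoms F) (VCat.mapHoms G) := by
  refine isPullback_of_isColimit X.isColimitHoms Y.isColimitHoms Z.isColimitHoms
    (VCat.pullbackCat F G).isColimitHoms (α := Prod.map F.obj F.obj) (β := Prod.map G.obj G.obj)
    (fun p ↦ VCat.inc_mapHoms _ _ _) (fun p ↦ VCat.inc_mapHoms _ _ _)
    (π := fun p : VCat.PullbackObj F G × VCat.PullbackObj F G ↦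
      ((p.1.1.1, p.2.1.1), (p.1.1.2, p.2.1.2))) ?_ ?_ ?_ (fun p ↦ VCat.inc_mapHoms _ _ _)
      (fun p ↦ VCat.inc_mapHoms _ _ _)
  · rintro ⟨⟨⟨x, y⟩, h⟩, ⟨⟨x', y'⟩, h'⟩⟩ ⟨⟨⟨x₂, y₂⟩, h₂⟩, ⟨⟨x₂', y₂'⟩, h₂'⟩⟩ e
    simp only [Prod.mk.injEq] at e
    obtain ⟨⟨rfl, rfl⟩, rfl, rfl⟩ := e
    rfl
  · rintro ⟨x, x'⟩ ⟨y, y'⟩ h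
    exact ⟨(⟨(x, y), congrArg Prod.fst h⟩, ⟨(x', y'), congrArg Prod.snd h⟩), rfl⟩
  · rintro ⟨p, q⟩
    -- The hom-object of the pullback is a pullback over one hom-object of `Z`. Composing with the
    -- monic injection `inc` places it over the coproduct and absorbs the cast between equal
    -- endpoints.
    have := isPullback_comp_mono (IsPullback.of_hasPullback
      (F.map p.1.1 q.1.1 ≫ VCat.castHom p.2 q.2) (G.map p.1.2 q.1.2))
      (VCat.inc (G.obj p.1.2) (G.obj q.1.2))
    rw [Category.assoc, VCat.castHom_inc] at this
    convert! this using 1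
    · exact VCat.inc_mapHoms _ _ _
    · exact VCat.inc_mapHoms _ _ _

variable (V) in
-- It suffices to treat the explicit pullback of `V`-categories, whose image is a pullback because
-- it is one on objects and one on arrows.
lemma inclusion_preservesPullbacks :
    PreservesLimitsOfShape WalkingCospan (inclusion V) where
  preservesLimit {K} := by
    have (X Y Z : VCat.{v} V) (F : X ⟶ Z) (G : Y ⟶ Z) : PreservesLimit (cospan F G) (inclusion V) :=
      preservesLimit_of_preserves_limit_cone (VCat.isPullback_pullbackCat F G).isLimit
        ((isLimitMapConePullbackConeEquiv _ (VCat.isPullback_pullbackCat F G).w).symm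
          (InternalCat.isPullback_of_isPullback (isPullback_mapObj F G)
            (isPullback_mapHoms F G) : IsPullback ((inclusion V).map _)
              ((inclusion V).map _) ((inclusion V).map _) ((inclusion V).map _)).isLimit)
    exact preservesLimit_of_iso_diagram _ (diagramIsoCospan K).symm

end Inclusion

/-! ### Surjectivity on objects -/

namespace VCat
variable {V : Type u} [Category.{v} V]

section
variable [MonoidalCategory V]

/-- The full `V`-subcategory on a set of objects. -/
def fullSubcategory (B : VCat.{w} V) (S : Set B) : VCat.{w} V where
  carrier := S
  str :=
    { Hom x y := (x.1 ⟶[V] y.1)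
      id x := eId V x.1
      comp x y z := eComp V x.1 y.1 z.1
      id_comp x y := e_id_comp V x.1 y.1
      comp_id x y := e_comp_id V x.1 y.1
      assoc x y z t := e_assoc V x.1 y.1 z.1 t.1 }

/-- The inclusion of a full `V`-subcategory. -/
def fullSubcategoryι (B : VCat.{w} V) (S : Set B) : B.fullSubcategory S ⟶ B where
  obj := Subtype.val
  map _ _ := 𝟙 _
  map_id x := Category.comp_id _
  map_comp x y z := (Category.comp_id _).trans
    ((congrArg (· ≫ eComp V x.1 y.1 z.1) (id_tensorHom_id _ _)).trans (Category.id_comp _)).symm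

lemma hom_ext_of_isEmpty {T P : VCat.{w} V} [IsEmpty P] (x y : T ⟶ P) : x = y :=
  EnrichedFunctor.ext V (fun t ↦ (IsEmpty.false (x.obj t)).elim)
    fun t _ ↦ (IsEmpty.false (x.obj t)).elim

end

/-- The full subcategory on the objects outside the image of `p` pulls back along `p` to an empty
category. Any map out of an empty pullback satisfies the descent condition, in particular the
identity; descending it would send the missed object `b` into an empty category. -/
lemma surjective_of_descendsMorphisms [CartesianMonoidalCategory V] [HasPullbacks V]
    {E B : VCat.{w} V} {p : E ⟶ B} (hp : DescendsMorphisms p) : Function.Surjective p.obj := by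
  intro b
  by_contra hb
  let ι := B.fullSubcategoryι (Set.range p.obj)ᶜ
  have : IsEmpty (pullbackCat ι p) := ⟨fun x : PullbackObj ι p ↦ x.1.1.2 ⟨_, x.2.symm⟩⟩
  obtain ⟨h, -⟩ := hp _ _ _ (isPullback_pullbackCat ι p) (pullbackFst ι p ≫ ι) (𝟙 _) (by simp)
    fun T x y _ ↦ congrArg (· ≫ 𝟙 _) (hom_ext_of_isEmpty x y)
  exact isEmptyElim (α := pullbackCat ι p) (h.obj ⟨b, hb⟩)

end VCat

/-! ### The `V`-category of a family of global objects -/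

namespace InternalCat
variable {V : Type u} [Category.{v} V] [CartesianMonoidalCategory V] [InfinitaryLextensive V]
  {A : InternalCat V} {S : Type v} (θ : coprodUnit S ⟶ A.obj)

/-- The object of arrows between two given global objects. -/
abbrev fib (s t : S) : V := pullback (pullback.fst A.src (pt s ≫ θ) ≫ A.tgt) (pt t ≫ θ)

/-- The inclusion of the object of arrows between two given global objects. -/
def fibInc (s t : S) : fib θ s t ⟶ A.arr := pullback.fst _ _ ≫ pullback.fst _ _

lemma fibInc_src (s t : S) : fibInc θ s t ≫ A.src = toUnit _ ≫ pt s ≫ θ := by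
  rw [fibInc, Category.assoc, pullback.condition, ← Category.assoc]
  congr 1
  exact toUnit_unique _ _

lemma fibInc_tgt (s t : S) : fibInc θ s t ≫ A.tgt = toUnit _ ≫ pt t ≫ θ := by
  rw [fibInc, Category.assoc, pullback.condition]
  congr 1
  exact toUnit_unique _ _

/-- Both legs discarded by `fibInc` land in the unit, which is terminal. Being monic, `fibInc`
reduces the axioms of a `V`-category to those of the internal category. -/
instance (s t : S) : Mono (fibInc θ s t) where
  right_cancellation f g h := pullback.hom_ext (pullback.hom_ext
    (by simpa [fibInc] using h) (toUnit_unique _ _)) (toUnit_unique _ _)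

variable {θ} in
/-- The universal property of the object of arrows between two given global objects. -/
def fibLift {s t : S} {T : V} (f : T ⟶ A.arr) (h : f ≫ A.src = toUnit T ≫ pt s ≫ θ)
    (h' : f ≫ A.tgt = toUnit T ≫ pt t ≫ θ) : T ⟶ fib θ s t :=
  pullback.lift (pullback.lift f (toUnit T) h) (toUnit T) (by
    rw [pullback.lift_fst_assoc, h'])

@[simp]
lemma fibLift_fibInc {s t : S} {T : V} (f : T ⟶ A.arr) (h : f ≫ A.src = toUnit T ≫ pt s ≫ θ)
    (h' : f ≫ A.tgt = toUnit T ≫ pt t ≫ θ) : fibLift f h h' ≫ fibInc θ s t = f := by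
  rw [fibLift, fibInc, pullback.lift_fst_assoc, pullback.lift_fst]

lemma fib_condition {s t r : S} {T : V} (f : T ⟶ fib θ s t) (g : T ⟶ fib θ t r) :
    (f ≫ fibInc θ s t) ≫ A.tgt = (g ≫ fibInc θ t r) ≫ A.src := by
  rw [Category.assoc, Category.assoc, fibInc_src, fibInc_tgt, ← Category.assoc f,
    ← Category.assoc g, toUnit_unique (f ≫ toUnit _) (g ≫ toUnit _)]

/-- The identities of the `V`-category of global objects. -/
def fibId (s : S) : 𝟙_ V ⟶ fib θ s s :=
  fibLift (pt s ≫ θ ≫ A.ident) (by simp [toUnit_unique (toUnit (𝟙_ V)) (𝟙 _)])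
    (by simp [toUnit_unique (toUnit (𝟙_ V)) (𝟙 _)])

/-- The composition of the `V`-category of global objects. -/
def fibComp (s t r : S) : fib θ s t ⊗ fib θ t r ⟶ fib θ s r :=
  fibLift (A.mul (fst _ _ ≫ fibInc θ s t) (snd _ _ ≫ fibInc θ t r) (fib_condition θ _ _))
    (by simp only [mul_src, Category.assoc, fibInc_src]
        rw [← Category.assoc]; congr 1; exact toUnit_unique _ _)
    (by simp only [mul_tgt, Category.assoc, fibInc_tgt]
        rw [← Category.assoc]; congr 1; exact toUnit_unique _ _)

lemma fibId_fibInc (s : S) : fibId θ s ≫ fibInc θ s s = pt s ≫ θ ≫ A.ident := by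
  rw [fibId, fibLift_fibInc]

lemma fibComp_fibInc (s t r : S) : fibComp θ s t r ≫ fibInc θ s r =
    A.mul (fst _ _ ≫ fibInc θ s t) (snd _ _ ≫ fibInc θ t r) (fib_condition θ _ _) := by
  rw [fibComp, fibLift_fibInc]

lemma comp_fibComp_fibInc {s t r : S} {T : V} (k : T ⟶ fib θ s t ⊗ fib θ t r) :
    k ≫ fibComp θ s t r ≫ fibInc θ s r = A.mul ((k ≫ fst _ _) ≫ fibInc θ s t)
      ((k ≫ snd _ _) ≫ fibInc θ t r) (fib_condition θ _ _) := by
  rw [fibComp_fibInc, comp_mul]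
  exact A.mul_congr (Category.assoc _ _ _).symm (Category.assoc _ _ _).symm

/-- The `V`-category of a family of global objects of an internal category. -/
def fibCat : VCat.{v} V where
  carrier := S
  str :=
    { Hom s t := fib θ s t
      id s := fibId θ s
      comp s t r := fibComp θ s t r
      id_comp s t := by
        rw [← cancel_mono (fibInc θ s t), Category.assoc, Category.assoc, Category.id_comp,
          ← Category.assoc, comp_fibComp_fibInc]
        refine (A.mul_congr ?_ ?_).trans (A.id_mul (fibInc θ s t))
        · simp [fibId, reassoc_of% (fibInc_src θ s t)]
        · simp
      comp_id s t := by
        rw [← cancel_mono (fibInc θ s t), Category.assoc, Category.assoc, Category.id_comp,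
          ← Category.assoc, comp_fibComp_fibInc]
        refine (A.mul_congr ?_ ?_).trans (A.mul_id (fibInc θ s t))
        · simp
        · simp [fibId, reassoc_of% (fibInc_tgt θ s t)]
      assoc s t r q := by
        rw [← cancel_mono (fibInc θ s q)]
        simp only [Category.assoc]
        rw [← Category.assoc, comp_fibComp_fibInc, comp_fibComp_fibInc]
        refine (A.mul_congr ?_ ?_).trans ((A.mul_assoc
          (fst (fib θ s t) (fib θ t r ⊗ fib θ r q) ≫ fibInc θ s t)
          ((snd _ _ ≫ fst _ _) ≫ fibInc θ t r) ((snd _ _ ≫ snd _ _) ≫ fibInc θ r q)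
          (fib_condition θ _ _) (fib_condition θ _ _)).trans (A.mul_congr ?_ ?_))
        · simp only [Category.assoc]
          rw [whiskerRight_fst_assoc, comp_fibComp_fibInc, comp_mul]
          exact A.mul_congr (by simp) (by simp)
        · simp
        · simp
        · simp only [Category.assoc]
          rw [whiskerLeft_snd_assoc, comp_fibComp_fibInc]
          exact A.mul_congr (by simp) (by simp) }

end InternalCat

/-! ### The essential image of the inclusion -/

namespace InternalCat
variable {V : Type u} [Category.{v} V] [CartesianMonoidalCategory V] [InfinitaryLextensive V]
  {A : InternalCat V} {S : Type v} (θ : coprodUnit S ⟶ A.obj)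

/-- When `θ` is invertible, the object of objects is a coproduct of points. Pulling this coproduct
back along the source splits the arrows by source, and then along the target splits each piece by
target. -/
lemma nonempty_isColimit_fibInc [IsIso θ] :
    Nonempty (IsColimit (Cofan.mk A.arr fun p : S × S ↦ fibInc θ p.1 p.2)) := by
  let d : Cofan fun _ : S ↦ 𝟙_ V := Cofan.mk A.obj fun s ↦ pt s ≫ θ
  have hd : IsColimit d := IsColimit.ofIsoColimit (coproductIsCoproduct fun _ : S ↦ 𝟙_ V)
    (Cofan.ext (asIso θ) fun _ ↦ rfl)
  obtain ⟨h₁⟩ := nonempty_isColimit_of_isPullback hd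
    (fun s ↦ pullback.snd A.src (pt s ≫ θ))
    (Cofan.mk A.arr fun s ↦ pullback.fst A.src (pt s ≫ θ)) A.src
    fun s ↦ IsPullback.of_hasPullback A.src (pt s ≫ θ)
  have h₂ (s : S) := nonempty_isColimit_of_isPullback hd
    (fun t ↦ pullback.snd (pullback.fst A.src (pt s ≫ θ) ≫ A.tgt) (pt t ≫ θ))
    (Cofan.mk (pullback A.src (pt s ≫ θ)) fun t ↦
      pullback.fst (pullback.fst A.src (pt s ≫ θ) ≫ A.tgt) (pt t ≫ θ))
    (pullback.fst A.src (pt s ≫ θ) ≫ A.tgt) fun t ↦ IsPullback.of_hasPullback _ (pt t ≫ θ)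
  exact ⟨IsColimit.ofIsoColimit (Cofan.IsColimit.prod _ (fun s ↦ (h₂ s).some) _ h₁)
    (Cofan.ext (Iso.refl _) fun _ ↦ Category.comp_id _)⟩

/-- The comparison of the object of objects of the `V`-category of global objects with the object
of objects. -/
def fibObj : coprodUnit (fibCat θ) ⟶ A.obj := θ

variable {θ} in
/-- The hom-objects of the `V`-category of global objects are objects of arrows. -/
def fibHom (x y : fibCat θ) : (x ⟶[V] y) ⟶ A.arr := fibInc θ x y

lemma eId_fibHom (x : fibCat θ) : eId V x ≫ fibHom x x = pt x ≫ fibObj θ ≫ A.ident :=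
  fibId_fibInc θ x

lemma fibHom_condition (x y z : fibCat θ) : (fst (x ⟶[V] y) (y ⟶[V] z) ≫ fibHom x y) ≫ A.tgt =
    (snd _ _ ≫ fibHom y z) ≫ A.src :=
  fib_condition θ _ _

lemma eComp_fibHom (x y z : fibCat θ) : eComp V x y z ≫ fibHom x z =
    A.mul (fst (x ⟶[V] y) (y ⟶[V] z) ≫ fibHom x y) (snd _ _ ≫ fibHom y z)
      (fibHom_condition θ x y z) :=
  fibComp_fibInc θ x y z

/-- The comparison of the coproduct of the objects of arrows between global objects with the
object of arrows. -/
def fibArr : (fibCat θ).homs ⟶ A.arr := Sigma.desc fun p ↦ fibHom p.1 p.2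

@[simp]
lemma inc_fibArr (x y : fibCat θ) : VCat.inc x y ≫ fibArr θ = fibHom x y := Sigma.ι_desc _ _

lemma isIso_fibArr [IsIso θ] : IsIso (fibArr θ) := by
  obtain ⟨h⟩ := nonempty_isColimit_fibInc θ
  let i := (fibCat θ).isColimitHoms.coconePointUniqueUpToIso h
  have e : fibArr θ = i.hom := VCat.homs_hom_ext fun x y ↦ (inc_fibArr θ x y).trans
    ((fibCat θ).isColimitHoms.comp_coconePointUniqueUpToIso_hom h ⟨(x, y)⟩).symm
  exact e ▸ i.isIso_hom

lemma fibHom_src (x y : fibCat θ) : fibHom x y ≫ A.src = toUnit _ ≫ pt x ≫ fibObj θ :=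
  fibInc_src θ x y

lemma fibHom_tgt (x y : fibCat θ) : fibHom x y ≫ A.tgt = toUnit _ ≫ pt y ≫ fibObj θ :=
  fibInc_tgt θ x y

lemma fibArr_src : fibArr θ ≫ A.src = (fibCat θ).src ≫ fibObj θ :=
  VCat.homs_hom_ext fun x y ↦ by
    rw [reassoc_of% (inc_fibArr θ x y), reassoc_of% (VCat.inc_src x y), fibHom_src]

lemma fibArr_tgt : fibArr θ ≫ A.tgt = (fibCat θ).tgt ≫ fibObj θ :=
  VCat.homs_hom_ext fun x y ↦ by
    rw [reassoc_of% (inc_fibArr θ x y), reassoc_of% (VCat.inc_tgt x y), fibHom_tgt]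

lemma ident_fibArr : (fibCat θ).ident ≫ fibArr θ = fibObj θ ≫ A.ident :=
  VCat.coprodUnit_hom_ext fun x ↦ by
    rw [reassoc_of% (VCat.pt_ident (X := fibCat θ) x), inc_fibArr, eId_fibHom]

lemma comp_fibArr : (fibCat θ).comp ≫ fibArr θ =
    pullback.lift (pullback.fst (fibCat θ).tgt (fibCat θ).src ≫ fibArr θ)
      (pullback.snd (fibCat θ).tgt (fibCat θ).src ≫ fibArr θ) (by
        rw [Category.assoc, Category.assoc, fibArr_src, fibArr_tgt, pullback.condition_assoc]) ≫
      A.comp := VCat.pairs_hom_ext fun x y z ↦ by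
  have h₁ := (Category.assoc _ _ _).symm.trans
    (VCat.lift_comp (X := fibCat θ) (fst (x ⟶[V] y) (y ⟶[V] z)) (snd _ _) =≫ fibArr θ)
  have e : lift (fst (x ⟶[V] y) (y ⟶[V] z)) (snd _ _) = 𝟙 _ := by ext <;> simp
  have h₂ : (lift (fst (x ⟶[V] y) (y ⟶[V] z)) (snd _ _) ≫ eComp V x y z ≫ VCat.inc x z) ≫
      fibArr θ = A.mul (fst (x ⟶[V] y) (y ⟶[V] z) ≫ fibHom x y) (snd _ _ ≫ fibHom y z)
        (fibHom_condition θ x y z) := by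
    rw [e, Category.id_comp, Category.assoc, inc_fibArr, eComp_fibHom]
  refine h₁.trans (h₂.trans (Eq.trans ?_ (A.comp_mul _ _ _ _).symm))
  exact A.mul_congr (by simp [pullback.lift_fst_assoc]) (by simp [pullback.lift_snd_assoc])

/-- The comparison of the `V`-category of a family of global objects with the internal
category. -/
def fibComparison : (inclusion V).obj (fibCat θ) ⟶ A where
  obj := fibObj θ
  arr := fibArr θ
  arr_src := fibArr_src θ
  arr_tgt := fibArr_tgt θ
  ident_arr := ident_fibArr θ
  comp_arr := comp_fibArr θ

/-- The comparison functor is `θ` on objects, and on arrows it compares two coproducts of the same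
fibres, so it is invertible in both components. -/
lemma mem_essImage_inclusion [IsIso θ] : (inclusion V).essImage A :=
  have : IsIso (fibComparison θ) :=
    isIso_of_isIso _ (inferInstanceAs (IsIso θ) : IsIso (fibObj θ)) (isIso_fibArr θ)
  ⟨fibCat θ, ⟨asIso (fibComparison θ)⟩⟩

/-- A descent datum along a surjection on objects is discrete on objects. -/
lemma mem_essImage_of_isPullback {X E B : VCat.{v} V} {p : E ⟶ B}
    (hp : Function.Surjective p.obj) {d : X ⟶ E} {A : InternalCat V}
    {q : (inclusion V).obj X ⟶ A} {a : A ⟶ (inclusion V).obj B}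
    (h : IsPullback q ((inclusion V).map d) a ((inclusion V).map p)) :
    (inclusion V).essImage A := by
  obtain ⟨sec, hsec⟩ := hp.hasRightInverse
  -- These are the objects of `X` lying over the chosen section of `p`. They will index the copies
  -- of the unit that make up the object of objects of `A`.
  let L := {m : X × B // d.obj m.1 = sec m.2}
  let σ : coprodUnit (V := V) B ⟶ coprodUnit E := Sigma.desc fun b ↦ pt (sec b)
  let u : coprodUnit (V := V) L ⟶ coprodUnit X := Sigma.desc fun l : L ↦ pt l.1.1
  let w : coprodUnit (V := V) L ⟶ coprodUnit B := Sigma.desc fun l : L ↦ pt l.1.2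
  have hσ (b : B) : pt b ≫ σ = pt (sec b) := Sigma.ι_desc _ _
  have h₁ : IsPullback u w (VCat.mapObj d) σ :=
    isPullback_coprodUnit (π := Subtype.val) Subtype.val_injective
      (fun i j ↦ ⟨fun e ↦ ⟨⟨(i, j), e⟩, rfl⟩, by rintro ⟨l, hl⟩; have := l.2; rwa [hl] at this⟩)
      (VCat.pt_mapObj d) hσ (fun _ ↦ Sigma.ι_desc _ _) (fun _ ↦ Sigma.ι_desc _ _)
  have h₂ : IsPullback q.obj (VCat.mapObj d) a.obj (VCat.mapObj p) := isPullback_obj h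
  -- Pulling `a.obj` back along `mapObj p` and then along `σ` is pulling it back along the identity,
  -- as `σ` is a section. Hence the composite from the coproduct over `L` to `A.obj` is invertible.
  have h₃ := h₁.flip.paste_vert h₂.flip
  have e : σ ≫ VCat.mapObj p = 𝟙 _ := VCat.coprodUnit_hom_ext fun b ↦ by
    rw [reassoc_of% hσ, VCat.pt_mapObj, hsec, Category.comp_id]
  have h₄ : IsPullback w (u ≫ q.obj) (𝟙 _) a.obj := e ▸ h₃
  have := h₄.isIso_snd_of_isIso
  exact mem_essImage_inclusion (u ≫ q.obj)

end InternalCat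

end EnrichedDescent

end

theorem mainTheorem12 {V : Type u} [Category.{v} V] [CartesianMonoidalCategory V]
    [EnrichedDescent.InfinitaryLextensive V]
    (hfact : ∀ {X Y : V} (f : X ⟶ Y), ∃ (Z : V) (e : X ⟶ Z) (m : Z ⟶ Y),
      IsRegularEpi e ∧ Mono m ∧ e ≫ m = f)
    (hJfull : (sigmaConst.{v}.obj (𝟙_ V) : Type v ⥤ V).Full)
    (hJfaithful : (sigmaConst.{v}.obj (𝟙_ V) : Type v ⥤ V).Faithful) :
    (EnrichedDescent.inclusion V).Full ∧ (EnrichedDescent.inclusion V).Faithful ∧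
      PreservesLimitsOfShape WalkingCospan (EnrichedDescent.inclusion V) ∧
      ∀ ⦃E B : EnrichedDescent.VCat.{v} V⦄ (p : E ⟶ B),
        EnrichedDescent.IsEffectiveDescent ((EnrichedDescent.inclusion V).map p) →
          EnrichedDescent.IsEffectiveDescent p := by
  have h₁ := EnrichedDescent.inclusion_full V hJfull
  have h₂ := EnrichedDescent.inclusion_faithful V hJfaithful
  have h₃ := EnrichedDescent.inclusion_preservesPullbacks V
  refine ⟨h₁, h₂, h₃, fun E B p hp ↦ ?_⟩
  have hm := (EnrichedDescent.descendsMorphisms_of_isEffectiveDescent hp).of_map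
  -- Descent of morphisms for `p` must be obtained before descent of objects: it gives the
  -- surjectivity that places the descended internal category in the essential image.
  have hs := EnrichedDescent.VCat.surjective_of_descendsMorphisms hm
  exact EnrichedDescent.isEffectiveDescent_of_descends hm
    ((EnrichedDescent.descendsObjects_of_isEffectiveDescent hp).of_map _
      fun X A q d a h ↦ EnrichedDescent.InternalCat.mem_essImage_of_isPullback hs h)
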